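/- Let $n\ge 1$ and let $T=(V,E)$ be the rooted binary tree of height $n$ (the root $\rho$ and every vertex at level less than $n$ have exactly two children, and the leaves are the vertices at level $n$). Let $(X_s)_{s\ge 0}$ be the continuous-time simple random walk on $T$ started at $\rho$: it waits an exponential time of mean $1$ at each visited vertex and then jumps to a uniformly chosen neighbour, all choices being independent. For $v\in V$ with degree $d_v$ let $L^v_s=\frac1{d_v}\int_0^s \mathbf 1_{\{X_r=v\}}\,dr$ be the local time at $v$, let $\tau(t)=\inf\{s\ge 0: L^\rho_s\ge t\}$ be the inverse local time at the root, and let $\tau_{\mathrm{cov}}$ be the first time at which $X$ has visited every vertex. (i) There is a constant $C$, independent of $n$ and $t$, such that for all $n\ge 1$ and all $t\ge 0$ the time $\tau(t)$ is almost surely finite and square integrable, and $$\mathbb E\,\tau(t)=2|E|\,t,\qquad \operatorname{Var}(\tau(t))\le C\cdot 2^{2n}\,t .$$ (ii) Bounds on the cover time in terms of inverse local times convert into bounds on the cover time itself. For each $n$ consider the walk on the tree of height $n$, and let $t_n\ge 0$ and $a_n\to\infty$ be real sequences. If $\mathbb P(\tau_{\mathrm{cov}}\le\tau(t_n))\to 1$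 as $n\to\infty$, then $\mathbb P\big(\sqrt{\tau_{\mathrm{cov}}/|E|}\le\sqrt{2t_n}+a_n\big)\to 1$. If $\mathbb P(\tau(t_n)\le\tau_{\mathrm{cov}})\to 1$, then $\mathbb P\big(\sqrt{\tau_{\mathrm{cov}}/|E|}\ge\sqrt{2t_n}-a_n\big)\to 1$. -/

import Mathlib

open MeasureTheory ProbabilityTheory Filter Topology
open scoped NNReal ENNReal

universe u

noncomputable section

/-! ### The binary tree of height `n` -/

/-- Vertices of the rooted binary tree of height `n`: binary words of length at most `n`.
The length of a word is the level of the vertex. -/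
abbrev TreeVertex (n : ℕ) : Type := {w : List Bool // w.length ≤ n}

instance (n : ℕ) : Fintype (TreeVertex n) :=
  @Fintype.ofFinite _ (List.finite_length_le Bool n).to_subtype

/-- The root is the empty word. -/
def treeRoot (n : ℕ) : TreeVertex n := ⟨[], Nat.zero_le n⟩

/-- The rooted binary tree of height `n`: the children of a word `w` of length less than `n`
are the two words obtained from `w` by adding one letter. -/
def binaryTree (n : ℕ) : SimpleGraph (TreeVertex n) where
  Adj u v := (∃ b : Bool, v.1 = b :: u.1) ∨ (∃ b : Bool, u.1 = b :: v.1)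
  symm := ⟨fun _ _ h => h.symm⟩
  loopless := ⟨by
    rintro u (⟨b, hb⟩ | ⟨b, hb⟩) <;> exact absurd (congrArg List.length hb) (by simp)⟩

instance (n : ℕ) : DecidableRel (binaryTree n).Adj := fun u v => by
  unfold binaryTree; infer_instance

/-- Every set of vertices is measurable. -/
instance (n : ℕ) : MeasurableSpace (TreeVertex n) := ⊤

/-! ### Continuous-time random walk on a finite graph -/

section RandomWalk

variable {V Ω : Type*} [Fintype V] [DecidableEq V]

/-- Transition probabilities of simple random walk: jump to a uniformly chosen neighbour. -/
def stepProb (G : SimpleGraph V) [DecidableRel G.Adj] (u v : V) : ℝ :=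
  if G.Adj u v then (G.degree u : ℝ)⁻¹ else 0

/-- `X` is the continuous-time random walk on `G` started at `ρ`: it is given by a jump chain
`Y`, which is the discrete-time simple random walk on `G` started at `ρ`, and by independent
holding times `S 0, S 1, …`, which are exponential of mean `1` and independent of `Y`.
Almost surely, `X` sits at `Y k` from time `S 0 + … + S (k - 1)` (included)
to time `S 0 + … + S k` (excluded). -/
def IsRandomWalk [MeasurableSpace V] [MeasurableSpace Ω] (G : SimpleGraph V)
    [DecidableRel G.Adj] (ρ : V) (P : Measure Ω) (X : ℝ≥0 → Ω → V) : Prop :=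
  ∃ (Y : ℕ → Ω → V) (S : ℕ → Ω → ℝ),
    (∀ k, Measurable (Y k)) ∧
    (∀ (k : ℕ) (y : ℕ → V), P.real {ω | ∀ i ≤ k, Y i ω = y i} =
      (if y 0 = ρ then 1 else 0) * ∏ i ∈ Finset.range k, stepProb G (y i) (y (i + 1))) ∧
    (∀ k, Measurable (S k)) ∧
    (∀ k, P.map (S k) = expMeasure 1) ∧
    iIndepFun S P ∧
    IndepFun (fun ω k => Y k ω) (fun ω k => S k ω) P ∧
    ∀ᵐ ω ∂P, ∀ (k : ℕ) (t : ℝ≥0), ∑ i ∈ Finset.range k, S i ω ≤ (t : ℝ) →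
      (t : ℝ) < ∑ i ∈ Finset.range (k + 1), S i ω → X t ω = Y k ω

/-- The local time at `v` up to time `t`: the time that `X` spends at `v` up to time `t`,
divided by the degree of `v`. -/
def localTime (G : SimpleGraph V) [DecidableRel G.Adj] (X : ℝ≥0 → Ω → V) (v : V) (t : ℝ≥0)
    (ω : Ω) : ℝ :=
  1 / (G.degree v : ℝ) * ∫ s in (0 : ℝ)..t, if X s.toNNReal ω = v then (1 : ℝ) else 0

/-- The inverse local time at `ρ`: the first time at which the local time at `ρ` is at least
`t` (and `∞` if there is no such time). -/
def inverseLocalTime (G : SimpleGraph V) [DecidableRel G.Adj] (X : ℝ≥0 → Ω → V) (ρ : V)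
    (t : ℝ) (ω : Ω) : ℝ≥0∞ :=
  ⨅ (s : ℝ≥0) (_ : t ≤ localTime G X ρ s ω), (s : ℝ≥0∞)

end RandomWalk

/-- The cover time: the first time at which every vertex has been visited
(and `∞` if there is no such time). -/
def coverTime {V Ω : Type*} (X : ℝ≥0 → Ω → V) (ω : Ω) : ℝ≥0∞ :=
  ⨅ (s : ℝ≥0) (_ : ∀ v : V, ∃ r ≤ s, X r ω = v), (s : ℝ≥0∞)

/-- The inverse local time at the root for a process on the binary tree of height `n`. -/
abbrev treeInverseLocalTime {Ω : Type*} (n : ℕ) (X : ℝ≥0 → Ω → TreeVertex n) (t : ℝ) (ω : Ω) :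
    ℝ≥0∞ :=
  inverseLocalTime (binaryTree n) X (treeRoot n) t ω

end

noncomputable section

/-! ### Integrals against the exponential distribution of mean `1` -/

/-! With `T = deg ρ · t`, the inverse local time is `τ(t) = T + D`, where `D` is the time spent away
from the root before the time at the root reaches `T` (`inverseLocalTime_eq`). Measured in root
time, excursions from the root start at rate 1, so `D` is heuristically a compound Poisson sum: its
mean is `cT` and its variance is `T` times the second moment of an excursion, `c` being the mean
excursion length.

This is made rigorous without excursion theory. The triple (vertex, root time, away time) is Markov
along the jump chain (`lintegral_step`, `lintegral_state_succ`), and explicit functions of it are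
martingales or supermartingales. They are built from the mean hitting time `h` of the root and from
an upper bound `q` for its second moment. One martingale gives `E D = cT`
(`lintegral_totalAwayTime`). A supermartingale gives `E D² ≤ (cT)² + KT`
(`lintegral_totalAwayTime_sq_le`), hence `Var D ≤ KT`. A third potential, decreasing by 1 per step,
shows that the root time does reach `T` (`tendsto_measure_rootTime_lt`).

Reversibility gives `2|E| = deg ρ · (1 + c)`, so `E τ(t) = 2|E|t`. On the tree, `h` and `q` are
functions of the level, and `K = 24 · 2^(2n)` works (`isHittingPotential_binaryTree`).

For the cover time, put `x = √(2t)`. Since `|E| ≥ 2^n`, Chebyshev's inequality gives `|τ(t) - |E|x²|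
< |E| a(x + a)/2` outside an event of probability at most `96/a²`. This puts `τ(t)` between `|E|(x -
a)²` (if `x > a`) and `|E|(x + a)²`, so comparisons with `τ(t)` transfer to the stated bounds. -/

lemma lintegral_expMeasure_one (f : ℝ → ℝ≥0∞) :
    ∫⁻ s, f s ∂(expMeasure 1) = ∫⁻ s in Set.Ioi 0, ENNReal.ofReal (Real.exp (-s)) * f s := by
  have h : expMeasure 1 = volume.withDensity (exponentialPDF 1) := rfl
  rw [h, lintegral_withDensity_eq_lintegral_mul_non_measurable]
  · rw [← lintegral_indicator measurableSet_Ioi]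
    refine lintegral_congr_ae ?_
    -- The density is 1 at 0 whereas the indicator of `Ioi 0` vanishes there; this null point is
    -- discarded.
    have h0 : ∀ᵐ s : ℝ, s ≠ 0 := by simp [ae_iff]
    filter_upwards [h0] with s hs
    rcases lt_or_gt_of_ne hs with hs | hs
    · simp [Set.indicator, exponentialPDF_of_neg hs, hs.le]
    · simp [Set.indicator, exponentialPDF_of_nonneg hs.le, hs]
  · unfold exponentialPDF
    fun_prop
  · exact ae_of_all _ fun s => by simp [exponentialPDF]

lemma ae_nonneg_expMeasure_one : ∀ᵐ s ∂(expMeasure 1), 0 ≤ s := by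
  have : expMeasure 1 (Set.Iio 0) = 0 := by
    rw [← lintegral_indicator_one measurableSet_Iio, lintegral_expMeasure_one,
      setLIntegral_congr_fun (g := fun _ => 0) measurableSet_Ioi]
    · simp
    · intro s hs
      have hs' : ¬ s < 0 := not_lt.2 (le_of_lt hs)
      simp [hs']
  rw [ae_iff]
  simpa [Set.Iio] using this

lemma lintegral_expMeasure_one_quadratic {a b c : ℝ} (ha : 0 ≤ a) (hb : 0 ≤ b) (hc : 0 ≤ c) :
    ∫⁻ s, ENNReal.ofReal (a + b * s + c * s ^ 2) ∂(expMeasure 1) =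
      ENNReal.ofReal (a + b + 2 * c) := by
  rw [lintegral_expMeasure_one]
  -- For a quadratic polynomial `p`, an antiderivative of `e^(-s) p` is `-e^(-s) (p + p' + p'')`.
  set g : ℝ → ℝ := fun s => -(Real.exp (-s) * (a + b * s + c * s ^ 2 + b + 2 * c * s + 2 * c))
  set g' : ℝ → ℝ := fun s => Real.exp (-s) * (a + b * s + c * s ^ 2)
  have hderiv : ∀ s ∈ Set.Ici (0 : ℝ), HasDerivAt g (g' s) s := by
    intro s _
    have h1 : HasDerivAt (fun s : ℝ => Real.exp (-s)) (-Real.exp (-s)) s := by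
      simpa using (hasDerivAt_neg s).exp
    have h2 : HasDerivAt (fun s : ℝ => a + b * s + c * s ^ 2 + b + 2 * c * s + 2 * c)
        (b + 2 * c * s + 2 * c) s := by
      have := (((((hasDerivAt_id s).const_mul b).const_add a).add
        ((hasDerivAt_pow 2 s).const_mul c)).add_const b).add
          ((hasDerivAt_id s).const_mul (2 * c)) |>.add_const (2 * c)
      refine this.congr_deriv ?_
      simp; ring
    refine (h1.mul h2).neg.congr_deriv ?_
    simp only [g']; ring
  have hpos : ∀ s ∈ Set.Ioi (0 : ℝ), 0 ≤ g' s := by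
    intro s hs
    have hs : 0 < s := hs
    positivity
  have hlim : Tendsto g atTop (𝓝 0) := by
    have h0 := Real.tendsto_pow_mul_exp_neg_atTop_nhds_zero 0
    have h1 := Real.tendsto_pow_mul_exp_neg_atTop_nhds_zero 1
    have h2 := Real.tendsto_pow_mul_exp_neg_atTop_nhds_zero 2
    have := (((h0.const_mul (a + b + 2 * c)).add (h1.const_mul (b + 2 * c))).add
      (h2.const_mul c)).neg
    convert this using 2
    · simp only [g]; ring
    · simp
  have hint := integrableOn_Ioi_deriv_of_nonneg' hderiv hpos hlim
  have hval := integral_Ioi_of_hasDerivAt_of_nonneg' hderiv hpos hlim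
  have : g 0 = -(a + b + 2 * c) := by simp [g]
  rw [this] at hval
  rw [show a + b + 2 * c = 0 - -(a + b + 2 * c) by ring, ← hval,
    ofReal_integral_eq_lintegral_ofReal hint]
  · refine lintegral_congr fun s => ?_
    rw [ENNReal.ofReal_mul (Real.exp_pos _).le]
  · exact (ae_restrict_mem measurableSet_Ioi).mono hpos

/-- With `f u = a u + b u²`, the truncated integrand is `(f + f')(r - s)`, and `-e^(-s) f(r - s)` is
an antiderivative of `e^(-s) (f + f')(r - s)`; moreover `f 0 = 0`. This is the step at the root,
where `r` is the root time still to be spent. -/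
lemma lintegral_expMeasure_one_truncated {a b d r : ℝ} (ha : 0 ≤ a) (hb : 0 ≤ b) (hd : 0 ≤ d)
    (hr : 0 ≤ r) :
    ∫⁻ s, ENNReal.ofReal (d + if s < r then a + (a + 2 * b) * (r - s) + b * (r - s) ^ 2 else 0)
      ∂(expMeasure 1) = ENNReal.ofReal (d + (a * r + b * r ^ 2)) := by
  have : IsProbabilityMeasure (expMeasure 1) := isProbabilityMeasure_expMeasure one_pos
  have hnn : ∀ s < r, 0 ≤ a + (a + 2 * b) * (r - s) + b * (r - s) ^ 2 := by
    intro s hs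
    have : 0 < r - s := sub_pos.2 hs
    positivity
  have hsplit : ∀ s : ℝ, ENNReal.ofReal
      (d + if s < r then a + (a + 2 * b) * (r - s) + b * (r - s) ^ 2 else 0) =
      ENNReal.ofReal d + ENNReal.ofReal
        (if s < r then a + (a + 2 * b) * (r - s) + b * (r - s) ^ 2 else 0) := by
    intro s
    refine ENNReal.ofReal_add hd ?_
    split_ifs with hs
    · exact hnn s hs
    · exact le_rfl
  simp_rw [hsplit]
  rw [lintegral_add_left measurable_const, ENNReal.ofReal_add hd (by positivity)]
  simp only [lintegral_const, measure_univ, mul_one]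
  congr 1
  rw [lintegral_expMeasure_one]
  set g : ℝ → ℝ := fun s => -(Real.exp (-s) * (a * (r - s) + b * (r - s) ^ 2))
  set g' : ℝ → ℝ := fun s => Real.exp (-s) * (a + (a + 2 * b) * (r - s) + b * (r - s) ^ 2)
  have hderiv : ∀ s : ℝ, HasDerivAt g (g' s) s := by
    intro s
    have h1 : HasDerivAt (fun s : ℝ => Real.exp (-s)) (-Real.exp (-s)) s := by
      simpa using (hasDerivAt_neg s).exp
    have h3 : HasDerivAt (fun s : ℝ => r - s) (-1) s := by
      simpa using (hasDerivAt_id s).const_sub r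
    have h2 : HasDerivAt (fun s : ℝ => a * (r - s) + b * (r - s) ^ 2)
        (-(a + 2 * b * (r - s))) s := by
      have := (h3.const_mul a).add ((h3.pow 2).const_mul b)
      refine this.congr_deriv ?_
      simp; ring
    refine (h1.mul h2).neg.congr_deriv ?_
    simp only [g']; ring
  have hcont : Continuous g' := by simp only [g']; fun_prop
  have hval : ∫ s in (0 : ℝ)..r, g' s = a * r + b * r ^ 2 := by
    rw [intervalIntegral.integral_eq_sub_of_hasDerivAt (fun s _ => hderiv s)
      (hcont.intervalIntegrable _ _)]
    simp [g]
  rw [← hval, intervalIntegral.integral_of_le hr, integral_Ioc_eq_integral_Ioo,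
    ofReal_integral_eq_lintegral_ofReal]
  · have : Set.Ioo 0 r = Set.Iio r ∩ Set.Ioi 0 := by ext; simp [and_comm]
    rw [this, ← setLIntegral_indicator measurableSet_Iio]
    refine lintegral_congr fun s => ?_
    by_cases hs : s < r
    · simp only [hs, if_true, Set.indicator, Set.mem_Iio, g']
      rw [ENNReal.ofReal_mul (Real.exp_pos _).le]
    · simp [hs]
  · exact (hcont.integrableOn_Icc (a := 0) (b := r)).mono_set Set.Ioo_subset_Icc_self
  · filter_upwards [ae_restrict_mem measurableSet_Ioo] with s hs
    exact mul_nonneg (Real.exp_pos _).le (hnn s hs.2)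

/-! ### The one-step Markov property of the jump chain with its holding times -/

section Markov

lemma stepProb_nonneg {V : Type*} [Fintype V] (G : SimpleGraph V) [DecidableRel G.Adj] (u v : V) :
    0 ≤ stepProb G u v := by
  unfold stepProb; split_ifs <;> positivity

variable {V Ω : Type*} [Fintype V] [DecidableEq V] [MeasurableSpace V] [MeasurableSpace Ω]

/-- `Y` is simple random walk on `G` started at `ρ`, and `S` is an independent sequence of
independent exponential holding times of mean `1`. -/
structure IsSkeleton (G : SimpleGraph V) [DecidableRel G.Adj] (ρ : V) (P : Measure Ω)
    (Y : ℕ → Ω → V) (S : ℕ → Ω → ℝ) : Prop where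
  measurable_chain : ∀ k, Measurable (Y k)
  law_chain : ∀ (k : ℕ) (y : ℕ → V), P.real {ω | ∀ i ≤ k, Y i ω = y i} =
    (if y 0 = ρ then 1 else 0) * ∏ i ∈ Finset.range k, stepProb G (y i) (y (i + 1))
  measurable_holding : ∀ k, Measurable (S k)
  law_holding : ∀ k, P.map (S k) = expMeasure 1
  indep_holding : iIndepFun S P
  indep : IndepFun (fun ω k => Y k ω) (fun ω k => S k ω) P

namespace IsSkeleton

variable {G : SimpleGraph V} [DecidableRel G.Adj] {ρ : V} {P : Measure Ω} {Y : ℕ → Ω → V}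
  {S : ℕ → Ω → ℝ}

lemma measure_history_succ [IsProbabilityMeasure P] (h : IsSkeleton G ρ P Y S) (k : ℕ)
    (y : ℕ → V) :
    P {ω | ∀ i ≤ k + 1, Y i ω = y i} =
      P {ω | ∀ i ≤ k, Y i ω = y i} * ENNReal.ofReal (stepProb G (y k) (y (k + 1))) := by
  have h1 := h.law_chain (k + 1) y
  rw [Finset.prod_range_succ, ← mul_assoc, ← h.law_chain k y] at h1
  rw [← ofReal_measureReal, h1, ENNReal.ofReal_mul measureReal_nonneg, ofReal_measureReal]

lemma ae_start [IsProbabilityMeasure P] [MeasurableSingletonClass V]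
    (h : IsSkeleton G ρ P Y S) : ∀ᵐ ω ∂P, Y 0 ω = ρ := by
  have h1 := h.law_chain 0 (fun _ => ρ)
  simp only [nonpos_iff_eq_zero, forall_eq, Finset.range_zero, Finset.prod_empty, mul_one,
    if_true] at h1
  refine (mem_ae_iff_prob_eq_one (h.measurable_chain 0 (measurableSet_singleton ρ))).2 ?_
  rw [← ofReal_measureReal, ← ENNReal.ofReal_one, ← h1]
  rfl

/-- Given the first `k` steps of the chain and the first `k` holding times, the next step of the
chain and the next holding time are independent, with the transition law and the exponential law
respectively. -/
theorem lintegral_step [IsProbabilityMeasure P] [MeasurableSingletonClass V]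
    (h : IsSkeleton G ρ P Y S) (k : ℕ)
    (Φ : (ℕ → V) → (ℕ → ℝ) → V → ℝ → ℝ≥0∞)
    (hmeas : ∀ y w, Measurable (fun p : (ℕ → ℝ) × ℝ => Φ y p.1 w p.2))
    (hloc : ∀ y y' s s', (∀ i ≤ k, y i = y' i) → (∀ i < k, s i = s' i) → Φ y s = Φ y' s') :
    ∫⁻ ω, Φ (fun i => Y i ω) (fun i => S i ω) (Y (k + 1) ω) (S k ω) ∂P =
      ∫⁻ ω, ∑ w, ENNReal.ofReal (stepProb G (Y k ω) w) *
        ∫⁻ x, Φ (fun i => Y i ω) (fun i => S i ω) w x ∂(expMeasure 1) ∂P := by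
  classical
  have : IsProbabilityMeasure (expMeasure 1) := isProbabilityMeasure_expMeasure one_pos
  have hY := h.measurable_chain
  have hS := h.measurable_holding
  have hSm : Measurable fun ω => fun i => S i ω := measurable_pi_lambda _ hS
  have hYm : Measurable fun ω => fun i => Y i ω := measurable_pi_lambda _ hY
  -- histories of the chain, extended to all times
  let ext : (Fin (k + 1) → V) → ℕ → V := fun y i =>
    if hi : i ≤ k then y ⟨i, Nat.lt_succ_of_le hi⟩ else ρ
  let hist : Ω → Fin (k + 1) → V := fun ω i => Y i ω
  have hext : ∀ y ω, hist ω = y → ∀ i ≤ k, Y i ω = ext y i := by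
    rintro y ω rfl i hi
    simp [ext, hist, hi]
  have hist_iff : ∀ y ω, hist ω = y ↔ ∀ i ≤ k, Y i ω = ext y i := by
    refine fun y ω => ⟨hext y ω, fun H => funext fun i => ?_⟩
    have := H i (Nat.lt_succ_iff.1 i.2)
    simpa [ext, hist, Nat.lt_succ_iff.1 i.2] using this
  have hΦ : ∀ ω y, hist ω = y → Φ (fun i => Y i ω) (fun i => S i ω) =
      Φ (ext y) (fun i => S i ω) :=
    fun ω y hy => hloc _ _ _ _ (hext y ω hy) fun _ _ => rfl
  let I : (Fin (k + 1) → V) → V → ℝ≥0∞ := fun y w =>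
    ∫⁻ ω, ∫⁻ x, Φ (ext y) (fun i => S i ω) w x ∂(expMeasure 1) ∂P
  have hmeas1 : ∀ y w, Measurable fun s : ℕ → ℝ => ∫⁻ x, Φ (ext y) s w x ∂(expMeasure 1) :=
    fun y w => (hmeas (ext y) w).lintegral_prod_right'
  -- integrate the last holding time
  have hI : ∀ y w, ∫⁻ ω, Φ (ext y) (fun i => S i ω) w (S k ω) ∂P = I y w := by
    intro y w
    -- By locality `Φ` ignores the entries from `k` on, so zeroing them changes nothing and leaves a
    -- sequence independent of `S k`.
    let trunc : (ℕ → ℝ) → ℕ → ℝ := fun s i => if i < k then s i else 0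
    have htr : ∀ s, Φ (ext y) s = Φ (ext y) (trunc s) := fun s =>
      hloc _ _ _ _ (fun _ _ => rfl) fun i hi => by simp [trunc, hi]
    have hind : IndepFun (fun ω => trunc fun i => S i ω) (S k) P := by
      have h1 := h.indep_holding.indepFun_finset (Finset.range k) {k} (by simp) hS
      have h2 := h1.comp
        (γ := ℕ → ℝ) (γ' := ℝ) (_mγ := inferInstance) (_mγ' := inferInstance)
        (φ := fun (s : Finset.range k → ℝ) (i : ℕ) =>
          if hi : i < k then s ⟨i, Finset.mem_range.2 hi⟩ else 0)
        (ψ := fun s : ({k} : Finset ℕ) → ℝ => s ⟨k, Finset.mem_singleton_self k⟩) ?_ ?_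
      · convert h2 using 1
        · funext ω i
          simp [trunc]
        · rfl
      · refine measurable_pi_lambda _ fun i => ?_
        by_cases hi : i < k
        · simp only [hi, dite_true]; fun_prop
        · simp only [hi, dite_false]; fun_prop
      · fun_prop
    have htm : Measurable fun ω => trunc fun i => S i ω := by
      refine measurable_pi_lambda _ fun i => ?_
      by_cases hi : i < k
      · simpa only [trunc, hi, if_true] using hS i
      · simp only [trunc, hi, if_false]; fun_prop
    calc ∫⁻ ω, Φ (ext y) (fun i => S i ω) w (S k ω) ∂P
        = ∫⁻ ω, Φ (ext y) (trunc fun i => S i ω) w (S k ω) ∂P :=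
          lintegral_congr fun ω => by rw [htr]
      _ = ∫⁻ p, Φ (ext y) p.1 w p.2 ∂(P.map fun ω => (trunc fun i => S i ω, S k ω)) :=
          (lintegral_map (hmeas (ext y) w) (htm.prodMk (hS k))).symm
      _ = ∫⁻ s, ∫⁻ x, Φ (ext y) s w x ∂(expMeasure 1) ∂(P.map fun ω => trunc fun i => S i ω) := by
          rw [(indepFun_iff_map_prod_eq_prod_map_map htm.aemeasurable (hS k).aemeasurable).1 hind,
            h.law_holding k, lintegral_prod _ (hmeas (ext y) w).aemeasurable]
      _ = ∫⁻ ω, ∫⁻ x, Φ (ext y) (trunc fun i => S i ω) w x ∂(expMeasure 1) ∂P :=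
          lintegral_map (hmeas1 y w) htm
      _ = I y w := lintegral_congr fun ω => by rw [← htr]
  have hset : ∀ (n : ℕ) (y : ℕ → V), MeasurableSet {z : ℕ → V | ∀ i ≤ n, z i = y i} := by
    intro n y
    have : {z : ℕ → V | ∀ i ≤ n, z i = y i} = ⋂ i ≤ n, (fun z => z i) ⁻¹' {y i} := by
      ext; simp
    rw [this]
    exact MeasurableSet.iInter fun i => MeasurableSet.iInter fun _ =>
      measurable_pi_apply i (measurableSet_singleton _)
  -- separate an event of the chain from the holding times
  have hsep : ∀ (n : ℕ) (y : ℕ → V) (f : (ℕ → ℝ) → ℝ≥0∞), Measurable f →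
      ∫⁻ ω, {ω | ∀ i ≤ n, Y i ω = y i}.indicator 1 ω * f (fun i => S i ω) ∂P =
        P {ω | ∀ i ≤ n, Y i ω = y i} * ∫⁻ ω, f (fun i => S i ω) ∂P := by
    intro n y f hf
    have hm : Measurable ({z : ℕ → V | ∀ i ≤ n, z i = y i}.indicator (1 : (ℕ → V) → ℝ≥0∞)) :=
      measurable_one.indicator (hset n y)
    have := lintegral_mul_eq_lintegral_mul_lintegral_of_indepFun (hm.comp hYm) (hf.comp hSm)
      (h.indep.comp hm hf)
    have h2 : ∫⁻ ω, {ω | ∀ i ≤ n, Y i ω = y i}.indicator (1 : Ω → ℝ≥0∞) ω ∂P =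
        P {ω | ∀ i ≤ n, Y i ω = y i} := lintegral_indicator_one (hYm (hset n y))
    rw [← h2]
    exact this
  have hindm : ∀ (n : ℕ) (y : ℕ → V),
      Measurable ({ω | ∀ i ≤ n, Y i ω = y i}.indicator (1 : Ω → ℝ≥0∞)) :=
    fun n y => measurable_one.indicator (hYm (hset n y))
  have hone : ∀ (n : ℕ) (y : ℕ → V) (ω : Ω), (∀ i ≤ n, Y i ω = y i) →
      {ω | ∀ i ≤ n, Y i ω = y i}.indicator (1 : Ω → ℝ≥0∞) ω = 1 :=
    fun n y ω H => Set.indicator_of_mem (s := {ω | ∀ i ≤ n, Y i ω = y i}) H 1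
  let ext' : (Fin (k + 1) → V) → V → ℕ → V := fun y w i => if i ≤ k then ext y i else w
  have hext' : ∀ y w ω, (∀ i ≤ k + 1, Y i ω = ext' y w i) ↔ (hist ω = y ∧ Y (k + 1) ω = w) := by
    intro y w ω
    rw [hist_iff]
    constructor
    · intro H
      refine ⟨fun i hi => ?_, ?_⟩
      · simpa only [ext', hi, if_true] using H i (hi.trans (Nat.le_succ k))
      · simpa [ext'] using H (k + 1) le_rfl
    · rintro ⟨H1, H2⟩ i hi
      rcases hi.lt_or_eq with hi | rfl
      · simpa only [ext', Nat.lt_succ_iff.1 hi, if_true] using H1 i (Nat.lt_succ_iff.1 hi)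
      · simpa [ext'] using H2
  -- There are finitely many histories of the chain: split over them, factor by independence of
  -- chain and holding times, pull out the last transition probability, then reassemble. Hence
  -- measurability of `Φ` is needed only for a fixed history.
  calc ∫⁻ ω, Φ (fun i => Y i ω) (fun i => S i ω) (Y (k + 1) ω) (S k ω) ∂P
      = ∫⁻ ω, ∑ y, ∑ w, {ω | ∀ i ≤ k + 1, Y i ω = ext' y w i}.indicator 1 ω *
          Φ (ext y) (fun i => S i ω) w (S k ω) ∂P := by
        refine lintegral_congr fun ω => ?_
        rw [Finset.sum_eq_single (hist ω), Finset.sum_eq_single (Y (k + 1) ω)]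
        · rw [hone _ _ _ ((hext' _ _ _).2 ⟨rfl, rfl⟩), one_mul,
            hΦ ω _ rfl]
        · intro w _ hw
          rw [Set.indicator_of_notMem, zero_mul]
          exact fun H => hw ((hext' _ _ _).1 H).2.symm
        · simp
        · intro y _ hy
          refine Finset.sum_eq_zero fun w _ => ?_
          rw [Set.indicator_of_notMem, zero_mul]
          exact fun H => hy ((hext' _ _ _).1 H).1.symm
        · simp
    _ = ∑ y, ∑ w, P {ω | ∀ i ≤ k + 1, Y i ω = ext' y w i} * I y w := by
        have hm : ∀ y w, Measurable fun ω => {ω | ∀ i ≤ k + 1, Y i ω = ext' y w i}.indicator 1 ω *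
            Φ (ext y) (fun i => S i ω) w (S k ω) :=
          fun y w => (hindm _ _).mul ((hmeas (ext y) w).comp (hSm.prodMk (hS k)))
        rw [lintegral_finsetSum _ fun y _ => Finset.measurable_fun_sum _ fun w _ => hm y w]
        refine Finset.sum_congr rfl fun y _ => ?_
        rw [lintegral_finsetSum _ fun w _ => hm y w]
        refine Finset.sum_congr rfl fun w _ => ?_
        rw [← hI]
        exact hsep (k + 1) (ext' y w) (fun s => Φ (ext y) s w (s k))
          ((hmeas (ext y) w).comp (measurable_id.prodMk (measurable_pi_apply k)))
    _ = ∑ y, ∑ w, P {ω | ∀ i ≤ k, Y i ω = ext y i} *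
          (ENNReal.ofReal (stepProb G (ext y k) w) * I y w) := by
        refine Finset.sum_congr rfl fun y _ => Finset.sum_congr rfl fun w _ => ?_
        rw [h.measure_history_succ, ← mul_assoc]
        have e1 : ext' y w (k + 1) = w := by simp [ext']
        have e2 : ext' y w k = ext y k := by simp [ext']
        rw [e1, e2]
        congr 4
        ext ω
        refine forall₂_congr fun i hi => ?_
        simp only [ext', hi, if_true]
    _ = ∫⁻ ω, ∑ y, ∑ w, {ω | ∀ i ≤ k, Y i ω = ext y i}.indicator 1 ω *
          (ENNReal.ofReal (stepProb G (ext y k) w) *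
            ∫⁻ x, Φ (ext y) (fun i => S i ω) w x ∂(expMeasure 1)) ∂P := by
        have hm : ∀ y w, Measurable fun s : ℕ → ℝ => ENNReal.ofReal (stepProb G (ext y k) w) *
            ∫⁻ x, Φ (ext y) s w x ∂(expMeasure 1) := fun y w => (hmeas1 y w).const_mul _
        have hm' : ∀ y w, Measurable fun ω => {ω | ∀ i ≤ k, Y i ω = ext y i}.indicator 1 ω *
            (ENNReal.ofReal (stepProb G (ext y k) w) *
              ∫⁻ x, Φ (ext y) (fun i => S i ω) w x ∂(expMeasure 1)) :=
          fun y w => (hindm _ _).mul ((hm y w).comp hSm)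
        rw [lintegral_finsetSum _ fun y _ => Finset.measurable_fun_sum _ fun w _ => hm' y w]
        refine Finset.sum_congr rfl fun y _ => ?_
        rw [lintegral_finsetSum _ fun w _ => hm' y w]
        refine Finset.sum_congr rfl fun w _ => ?_
        rw [hsep k (ext y) _ (hm y w)]
        congr 1
        exact (lintegral_const_mul _ ((hmeas1 y w).comp hSm)).symm
    _ = _ := by
        refine lintegral_congr fun ω => ?_
        rw [Finset.sum_eq_single (hist ω)]
        · refine Finset.sum_congr rfl fun w _ => ?_
          rw [hone _ _ _ ((hist_iff _ _).1 rfl), one_mul, hΦ ω _ rfl,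
            ← hext _ ω rfl k le_rfl]
        · intro y _ hy
          refine Finset.sum_eq_zero fun w _ => ?_
          rw [Set.indicator_of_notMem, zero_mul]
          exact fun H => hy ((hist_iff _ _).2 H).symm
        · simp

end IsSkeleton

end Markov

/-! ### Potentials for the time spent at and away from the root -/

section Potential

variable {V Ω : Type*} [DecidableEq V]

/-- The time spent at `ρ` during the first `k` visits of the chain `y` with holding times `s`. -/
def rootTime (ρ : V) (y : ℕ → V) (s : ℕ → ℝ) (k : ℕ) : ℝ :=
  ∑ i ∈ Finset.range k, if y i = ρ then s i else 0

/-- The time spent away from `ρ` during the first `k` visits, counted only as long as the time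
spent at `ρ` is less than `T`. -/
def awayTime (ρ : V) (T : ℝ) (y : ℕ → V) (s : ℕ → ℝ) (k : ℕ) : ℝ :=
  ∑ i ∈ Finset.range k, if y i ≠ ρ ∧ rootTime ρ y s i < T then s i else 0

lemma rootTime_succ (ρ : V) (y : ℕ → V) (s : ℕ → ℝ) (k : ℕ) :
    rootTime ρ y s (k + 1) = rootTime ρ y s k + if y k = ρ then s k else 0 :=
  Finset.sum_range_succ _ _

lemma awayTime_succ (ρ : V) (T : ℝ) (y : ℕ → V) (s : ℕ → ℝ) (k : ℕ) :
    awayTime ρ T y s (k + 1) =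
      awayTime ρ T y s k + if y k ≠ ρ ∧ rootTime ρ y s k < T then s k else 0 :=
  Finset.sum_range_succ _ _

lemma rootTime_congr (ρ : V) {y y' : ℕ → V} {s s' : ℕ → ℝ} {k : ℕ} (hy : ∀ i < k, y i = y' i)
    (hs : ∀ i < k, s i = s' i) : rootTime ρ y s k = rootTime ρ y' s' k := by
  refine Finset.sum_congr rfl fun i hi => ?_
  rw [hy i (Finset.mem_range.1 hi), hs i (Finset.mem_range.1 hi)]

lemma awayTime_congr (ρ : V) (T : ℝ) {y y' : ℕ → V} {s s' : ℕ → ℝ} {k : ℕ}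
    (hy : ∀ i < k, y i = y' i) (hs : ∀ i < k, s i = s' i) :
    awayTime ρ T y s k = awayTime ρ T y' s' k := by
  refine Finset.sum_congr rfl fun i hi => ?_
  have hi := Finset.mem_range.1 hi
  rw [hy i hi, hs i hi, rootTime_congr ρ (fun j hj => hy j (hj.trans hi))
    (fun j hj => hs j (hj.trans hi))]

lemma awayTime_nonneg (ρ : V) (T : ℝ) (y : ℕ → V) {s : ℕ → ℝ} (hs : ∀ i, 0 ≤ s i) (k : ℕ) :
    0 ≤ awayTime ρ T y s k :=
  Finset.sum_nonneg fun i _ => by split_ifs <;> simp [hs]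

lemma monotone_awayTime (ρ : V) (T : ℝ) (y : ℕ → V) {s : ℕ → ℝ} (hs : ∀ i, 0 ≤ s i) :
    Monotone (awayTime ρ T y s) := by
  refine monotone_nat_of_le_succ fun k => ?_
  rw [awayTime_succ]
  refine le_add_of_nonneg_right ?_
  split_ifs <;> simp [hs]

lemma monotone_rootTime (ρ : V) (y : ℕ → V) {s : ℕ → ℝ} (hs : ∀ i, 0 ≤ s i) :
    Monotone (rootTime ρ y s) := by
  refine monotone_nat_of_le_succ fun k => ?_
  rw [rootTime_succ]
  refine le_add_of_nonneg_right ?_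
  split_ifs <;> simp [hs]

lemma measurable_rootTime (ρ : V) (y : ℕ → V) (k : ℕ) :
    Measurable fun s : ℕ → ℝ => rootTime ρ y s k := by
  refine Finset.measurable_fun_sum _ fun i _ => ?_
  split_ifs <;> fun_prop

lemma measurable_awayTime (ρ : V) (T : ℝ) (y : ℕ → V) (k : ℕ) :
    Measurable fun s : ℕ → ℝ => awayTime ρ T y s k := by
  refine Finset.measurable_fun_sum _ fun i _ => ?_
  by_cases hi : y i = ρ
  · simp [hi]
  · simp only [ne_eq, hi, not_false_eq_true, true_and]
    exact Measurable.ite (measurableSet_lt (measurable_rootTime ρ y i) measurable_const)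
      (measurable_pi_apply i) measurable_const

variable [Fintype V]

/-- The mean of `F` after one step of the process formed by the current vertex, the time spent at
`ρ` and the time spent away from `ρ`. -/
def stepMean (G : SimpleGraph V) [DecidableRel G.Adj] (ρ : V) (T : ℝ) (F : V → ℝ → ℝ → ℝ≥0∞)
    (v : V) (a d : ℝ) : ℝ≥0∞ :=
  ∑ w, ENNReal.ofReal (stepProb G v w) * ∫⁻ x, F w (a + if v = ρ then x else 0)
    (d + if v ≠ ρ ∧ a < T then x else 0) ∂(expMeasure 1)

/-- The function `h` is the mean hitting time of `ρ`, the mean hitting time after a step from `ρ`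
is `c`, and `q` is an upper bound for the second moment of the time to hit `ρ`, with mean at most
`K` after a step from `ρ`. -/
structure IsHittingPotential (G : SimpleGraph V) [DecidableRel G.Adj] (ρ : V) (h q : V → ℝ)
    (c K : ℝ) : Prop where
  sum_stepProb : ∀ v, ∑ w, stepProb G v w = 1
  nonneg : ∀ v, 0 ≤ h v
  root : h ρ = 0
  step : ∀ v, v ≠ ρ → ∑ w, stepProb G v w * h w = h v - 1
  step_root : ∑ w, stepProb G ρ w * h w = c
  sq_nonneg : ∀ v, 0 ≤ q v
  sq_root : q ρ = 0
  sq_step : ∀ v, v ≠ ρ → ∑ w, stepProb G v w * q w ≤ q v - 2 * h v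
  sq_step_root : ∑ w, stepProb G ρ w * q w ≤ K

variable {G : SimpleGraph V} [DecidableRel G.Adj] {ρ : V} {h q : V → ℝ} {c K T : ℝ}

lemma stepMean_ofReal (f : V → ℝ → ℝ → ℝ) (hf : ∀ w, Measurable fun p : ℝ × ℝ => f w p.1 p.2)
    {v : V} {a d : ℝ} (hd : 0 ≤ d) (hf0 : ∀ w a d, 0 ≤ d → 0 ≤ f w a d) :
    stepMean G ρ T (fun w a d => ENNReal.ofReal (f w a d)) v a d =
      ∫⁻ x, ENNReal.ofReal (∑ w, stepProb G v w * f w (a + if v = ρ then x else 0)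
        (d + if v ≠ ρ ∧ a < T then x else 0)) ∂(expMeasure 1) := by
  have hm1 : Measurable fun x : ℝ => a + if v = ρ then x else 0 := by
    split_ifs <;> fun_prop
  have hm2 : Measurable fun x : ℝ => d + if v ≠ ρ ∧ a < T then x else 0 := by
    split_ifs <;> fun_prop
  have hm : ∀ w, Measurable fun x => f w (a + if v = ρ then x else 0)
      (d + if v ≠ ρ ∧ a < T then x else 0) := fun w => (hf w).comp (hm1.prodMk hm2)
  have hd' : ∀ x : ℝ, 0 ≤ x → 0 ≤ d + if v ≠ ρ ∧ a < T then x else 0 := by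
    intro x hx; split_ifs <;> positivity
  unfold stepMean
  have key : ∀ᵐ x ∂(expMeasure 1), ENNReal.ofReal (∑ w, stepProb G v w *
      f w (a + if v = ρ then x else 0) (d + if v ≠ ρ ∧ a < T then x else 0)) =
      ∑ w, ENNReal.ofReal (stepProb G v w) * ENNReal.ofReal (f w (a + if v = ρ then x else 0)
        (d + if v ≠ ρ ∧ a < T then x else 0)) := by
    filter_upwards [ae_nonneg_expMeasure_one] with x hx
    rw [ENNReal.ofReal_sum_of_nonneg]
    · exact Finset.sum_congr rfl fun w _ => ENNReal.ofReal_mul (stepProb_nonneg G v w)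
    · exact fun w _ => mul_nonneg (stepProb_nonneg G v w) (hf0 _ _ _ (hd' x hx))
  rw [lintegral_congr_ae key, lintegral_finsetSum _ fun w _ => (hm w).ennreal_ofReal.const_mul _]
  refine Finset.sum_congr rfl fun w _ => ?_
  rw [lintegral_const_mul _ (hm w).ennreal_ofReal]

namespace IsHittingPotential

omit [DecidableEq V] in
lemma nonneg_root (H : IsHittingPotential G ρ h q c K) : 0 ≤ c := by
  rw [← H.step_root]
  exact Finset.sum_nonneg fun w _ => mul_nonneg (stepProb_nonneg G ρ w) (H.nonneg w)

omit [DecidableEq V] in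
lemma sq_nonneg_root (H : IsHittingPotential G ρ h q c K) : 0 ≤ K :=
  le_trans (Finset.sum_nonneg fun w _ => mul_nonneg (stepProb_nonneg G ρ w) (H.sq_nonneg w))
    H.sq_step_root

omit [DecidableEq V] in
lemma sum_affine (H : IsHittingPotential G ρ h q c K) (v : V) (b₀ b₁ b₂ : ℝ) :
    ∑ w, stepProb G v w * (b₀ + b₁ * h w + b₂ * q w) =
      b₀ + b₁ * ∑ w, stepProb G v w * h w + b₂ * ∑ w, stepProb G v w * q w := by
  rw [Finset.mul_sum, Finset.mul_sum]
  nth_rw 2 [← mul_one b₀]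
  rw [← H.sum_stepProb v, Finset.mul_sum, ← Finset.sum_add_distrib, ← Finset.sum_add_distrib]
  exact Finset.sum_congr rfl fun w _ => by ring

omit [DecidableEq V] in
lemma sum_const (H : IsHittingPotential G ρ h q c K) (v : V) (b : ℝ) :
    ∑ w, stepProb G v w * b = b := by
  rw [← Finset.sum_mul, H.sum_stepProb, one_mul]

end IsHittingPotential

/-- The potential of the mean time away from `ρ` (for `α = 0`) and of the mean number of steps
(for `α = 1`) before the time spent at `ρ` reaches `T`. -/
def meanPotential (h : V → ℝ) (c T α : ℝ) (v : V) (a d : ℝ) : ℝ :=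
  (1 - α) * d + if a < T then h v + α + (c + α) * (T - a) else 0

/-- The potential of the second moment of the time away from `ρ` before the time spent at `ρ`
reaches `T`. -/
def sqPotential (h q : V → ℝ) (c K T : ℝ) (v : V) (a d : ℝ) : ℝ :=
  d ^ 2 + if a < T then 2 * d * (h v + c * (T - a)) +
    (q v + 2 * h v * (c * (T - a)) + (c * (T - a)) ^ 2 + K * (T - a)) else 0

namespace IsHittingPotential

omit [DecidableEq V] in
lemma meanPotential_nonneg (H : IsHittingPotential G ρ h q c K) {α : ℝ} (hα : 0 ≤ α)
    (hα1 : α ≤ 1) (v : V) (a : ℝ) {d : ℝ} (hd : 0 ≤ d) : 0 ≤ meanPotential h c T α v a d := by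
  unfold meanPotential
  have := H.nonneg v
  have := H.nonneg_root
  have := sub_nonneg.2 hα1
  split_ifs with ha
  · have := sub_pos.2 ha
    positivity
  · positivity

omit [DecidableEq V] in
lemma sqPotential_nonneg (H : IsHittingPotential G ρ h q c K) (v : V) (a : ℝ) {d : ℝ}
    (hd : 0 ≤ d) : 0 ≤ sqPotential h q c K T v a d := by
  unfold sqPotential
  have := H.nonneg v
  have := H.sq_nonneg v
  have := H.nonneg_root
  have := H.sq_nonneg_root
  split_ifs with ha
  · have := sub_pos.2 ha
    positivity
  · positivity

end IsHittingPotential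

omit [DecidableEq V] [Fintype V] in
lemma measurable_meanPotential (h : V → ℝ) (c T α : ℝ) (v : V) :
    Measurable fun p : ℝ × ℝ => meanPotential h c T α v p.1 p.2 := by
  unfold meanPotential
  refine Measurable.add (by fun_prop) (Measurable.ite ?_ (by fun_prop) measurable_const)
  exact measurableSet_lt measurable_fst measurable_const

omit [DecidableEq V] [Fintype V] in
lemma measurable_sqPotential (h q : V → ℝ) (c K T : ℝ) (v : V) :
    Measurable fun p : ℝ × ℝ => sqPotential h q c K T v p.1 p.2 := by
  unfold sqPotential
  refine Measurable.add (by fun_prop) (Measurable.ite ?_ (by fun_prop) measurable_const)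
  exact measurableSet_lt measurable_fst measurable_const

namespace IsHittingPotential

/-- The potential is the conditional mean of the final quantity. From `v` it costs `h v` to hit the
root, in time as in steps; afterwards each unit of root time costs `c` in away time, or `c + 1` in
steps, with one extra step for the visit during which `T` is crossed. For `α = 0` this is a
martingale; for `α = 1` it loses exactly 1 per step while the root time is below `T`. -/
theorem stepMean_meanPotential (H : IsHittingPotential G ρ h q c K) {α : ℝ} (hα : 0 ≤ α)
    (hα1 : α ≤ 1) (v : V) (a : ℝ) {d : ℝ} (hd : 0 ≤ d) :
    stepMean G ρ T (fun w a d => ENNReal.ofReal (meanPotential h c T α w a d)) v a d +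
      ENNReal.ofReal (if a < T then α else 0) =
      ENNReal.ofReal (meanPotential h c T α v a d) := by
  have : IsProbabilityMeasure (expMeasure 1) := isProbabilityMeasure_expMeasure one_pos
  have hc := H.nonneg_root
  have hh := H.nonneg
  have hα' := sub_nonneg.2 hα1
  rw [stepMean_ofReal _ (measurable_meanPotential h c T α) hd
    fun w a d hd => H.meanPotential_nonneg hα hα1 w a hd]
  by_cases ha : a < T
  · have hr := sub_pos.2 ha
    by_cases hv : v = ρ
    · subst hv
      have : ∀ x, ∑ w, stepProb G v w * meanPotential h c T α w (a + if v = v then x else 0)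
          (d + if v ≠ v ∧ a < T then x else 0) = (1 - α) * d + if x < T - a then
            (c + α) + ((c + α) + 2 * 0) * (T - a - x) + 0 * (T - a - x) ^ 2 else 0 := by
        intro x
        simp only [meanPotential, if_true, ne_eq, not_true_eq_false, false_and, if_false, add_zero]
        by_cases hx : x < T - a
        · have hx' : a + x < T := by linarith
          simp only [hx, hx', if_true]
          have h1 := H.sum_affine v ((1 - α) * d + α + (c + α) * (T - (a + x))) 1 0
          rw [H.step_root] at h1
          refine Eq.trans ?_ (h1.trans ?_)
          · exact Finset.sum_congr rfl fun w _ => by ring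
          · ring
        · have hx' : ¬ a + x < T := by linarith
          simp only [hx, hx', if_false, H.sum_const]
      rw [lintegral_congr fun x => congrArg ENNReal.ofReal (this x),
        lintegral_expMeasure_one_truncated (by positivity) le_rfl (by positivity) hr.le]
      simp only [meanPotential, if_pos ha, H.root]
      rw [← ENNReal.ofReal_add (by positivity) hα]
      congr 1
      ring
    · have : ∀ x, ∑ w, stepProb G v w * meanPotential h c T α w (a + if v = ρ then x else 0)
          (d + if v ≠ ρ ∧ a < T then x else 0) =
          ((1 - α) * d + (∑ w, stepProb G v w * h w + α + (c + α) * (T - a))) + (1 - α) * x +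
            0 * x ^ 2 := by
        intro x
        simp only [meanPotential, hv, if_true, ne_eq, not_false_eq_true, true_and, if_false, ha,
          add_zero]
        have h1 := H.sum_affine v ((1 - α) * (d + x) + α + (c + α) * (T - a)) 1 0
        refine Eq.trans ?_ (h1.trans ?_)
        · exact Finset.sum_congr rfl fun w _ => by ring
        · ring
      simp_rw [this]
      have hs : 0 ≤ ∑ w, stepProb G v w * h w :=
        Finset.sum_nonneg fun w _ => mul_nonneg (stepProb_nonneg G v w) (hh w)
      rw [lintegral_expMeasure_one_quadratic (by positivity) hα' le_rfl]
      simp only [meanPotential, if_pos ha]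
      rw [← ENNReal.ofReal_add (by positivity) hα, H.step v hv]
      congr 1
      ring
  -- Once the root time has reached `T` it stays there or grows, and the away time is frozen.
  · have : ∀ᵐ x ∂(expMeasure 1), ENNReal.ofReal (∑ w, stepProb G v w *
        meanPotential h c T α w (a + if v = ρ then x else 0)
          (d + if v ≠ ρ ∧ a < T then x else 0)) = ENNReal.ofReal ((1 - α) * d) := by
      filter_upwards [ae_nonneg_expMeasure_one] with x hx
      have h1 : ¬ (a + if v = ρ then x else 0) < T := by split_ifs <;> linarith
      simp only [meanPotential, h1, ha, and_false, if_false, add_zero, H.sum_const]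
    rw [lintegral_congr_ae this]
    simp [meanPotential, ha]

/-- Write the final away time as `d + H + R`, with `H` the time to hit the root and `R` the
independent contribution of the remaining root time `r = T - a`. Expanding the square with `E H =
h`, `E H² ≤ q`, `E R = c r` and `E R² ≤ (c r)² + K r` gives the potential. Only the two inequalities
on `q` prevent equality. -/
theorem stepMean_sqPotential_le (H : IsHittingPotential G ρ h q c K) (v : V) (a : ℝ) {d : ℝ}
    (hd : 0 ≤ d) :
    stepMean G ρ T (fun w a d => ENNReal.ofReal (sqPotential h q c K T w a d)) v a d ≤
      ENNReal.ofReal (sqPotential h q c K T v a d) := by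
  have : IsProbabilityMeasure (expMeasure 1) := isProbabilityMeasure_expMeasure one_pos
  have hc := H.nonneg_root
  have hK := H.sq_nonneg_root
  have hh := H.nonneg
  rw [stepMean_ofReal _ (measurable_sqPotential h q c K T) hd
    fun w a d hd => H.sqPotential_nonneg w a hd]
  by_cases ha : a < T
  · have hr := sub_pos.2 ha
    by_cases hv : v = ρ
    · subst hv
      have : ∀ x, ∑ w, stepProb G v w * sqPotential h q c K T w (a + if v = v then x else 0)
          (d + if v ≠ v ∧ a < T then x else 0) ≤ d ^ 2 + if x < T - a then
            (2 * d * c + K) + ((2 * d * c + K) + 2 * c ^ 2) * (T - a - x) +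
              c ^ 2 * (T - a - x) ^ 2 else 0 := by
        intro x
        simp only [sqPotential, if_true, ne_eq, not_true_eq_false, false_and, if_false, add_zero]
        by_cases hx : x < T - a
        · have hx' : a + x < T := by linarith
          simp only [hx, hx', if_true]
          have h1 := H.sum_affine v (d ^ 2 + 2 * d * (c * (T - (a + x))) +
            (c * (T - (a + x))) ^ 2 + K * (T - (a + x))) (2 * d + 2 * (c * (T - (a + x)))) 1
          rw [H.step_root] at h1
          have h2 := H.sq_step_root
          refine le_trans (le_of_eq ?_) (h1.le.trans ?_)
          · exact Finset.sum_congr rfl fun w _ => by ring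
          · linarith
        · have hx' : ¬ a + x < T := by linarith
          simp only [hx, hx', if_false, H.sum_const]
          exact le_rfl
      refine (lintegral_mono fun x => ENNReal.ofReal_le_ofReal (this x)).trans (le_of_eq ?_)
      rw [lintegral_expMeasure_one_truncated (by positivity) (by positivity) (by positivity) hr.le]
      simp only [sqPotential, if_pos ha, H.root, H.sq_root]
      congr 1
      ring
    · have hs : 0 ≤ ∑ w, stepProb G v w * h w :=
        Finset.sum_nonneg fun w _ => mul_nonneg (stepProb_nonneg G v w) (hh w)
      have hs2 : 0 ≤ ∑ w, stepProb G v w * q w :=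
        Finset.sum_nonneg fun w _ => mul_nonneg (stepProb_nonneg G v w) (H.sq_nonneg w)
      set Ph := ∑ w, stepProb G v w * h w
      set Pq := ∑ w, stepProb G v w * q w
      have : ∀ x, ∑ w, stepProb G v w * sqPotential h q c K T w (a + if v = ρ then x else 0)
          (d + if v ≠ ρ ∧ a < T then x else 0) =
          (d ^ 2 + 2 * d * (Ph + c * (T - a)) +
            (Pq + 2 * Ph * (c * (T - a)) + (c * (T - a)) ^ 2 + K * (T - a))) +
            (2 * d + 2 * (Ph + c * (T - a))) * x + 1 * x ^ 2 := by
        intro x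
        simp only [sqPotential, hv, if_true, ne_eq, not_false_eq_true, true_and, if_false, ha,
          add_zero]
        have h1 := H.sum_affine v ((d + x) ^ 2 + 2 * (d + x) * (c * (T - a)) +
            (c * (T - a)) ^ 2 + K * (T - a)) (2 * (d + x) + 2 * (c * (T - a))) 1
        refine Eq.trans ?_ (h1.trans ?_)
        · exact Finset.sum_congr rfl fun w _ => by ring
        · ring
      simp_rw [this]
      rw [lintegral_expMeasure_one_quadratic (by positivity) (by positivity) zero_le_one]
      simp only [sqPotential, if_pos ha]
      refine ENNReal.ofReal_le_ofReal ?_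
      have h2 : Pq ≤ q v - 2 * h v := H.sq_step v hv
      have h3 : Ph = h v - 1 := H.step v hv
      rw [h3]
      linarith
  · have : ∀ᵐ x ∂(expMeasure 1), ENNReal.ofReal (∑ w, stepProb G v w *
        sqPotential h q c K T w (a + if v = ρ then x else 0)
          (d + if v ≠ ρ ∧ a < T then x else 0)) = ENNReal.ofReal (d ^ 2) := by
      filter_upwards [ae_nonneg_expMeasure_one] with x hx
      have h1 : ¬ (a + if v = ρ then x else 0) < T := by split_ifs <;> linarith
      simp only [sqPotential, h1, ha, and_false, if_false, add_zero, H.sum_const]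
    rw [lintegral_congr_ae this]
    simp [sqPotential, ha]

end IsHittingPotential

end Potential

/-! ### Moments of the total time away from the root -/

section Moments

variable {V Ω : Type*} [Fintype V] [DecidableEq V] [MeasurableSpace V] [MeasurableSpace Ω]
  {G : SimpleGraph V} [DecidableRel G.Adj] {ρ : V} {P : Measure Ω} {Y : ℕ → Ω → V}
  {S : ℕ → Ω → ℝ} {h q : V → ℝ} {c K T : ℝ}

namespace IsSkeleton

lemma ae_holding_nonneg (hw : IsSkeleton G ρ P Y S) : ∀ᵐ ω ∂P, ∀ i, 0 ≤ S i ω := by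
  refine ae_all_iff.2 fun i => ?_
  have h1 := ae_nonneg_expMeasure_one
  rw [← hw.law_holding i] at h1
  exact ae_of_ae_map (hw.measurable_holding i).aemeasurable h1

variable [MeasurableSingletonClass V]

lemma measurable_rootTime (hw : IsSkeleton G ρ P Y S) (k : ℕ) :
    Measurable fun ω => rootTime ρ (fun i => Y i ω) (fun i => S i ω) k := by
  refine Finset.measurable_fun_sum _ fun i _ => ?_
  exact Measurable.ite (hw.measurable_chain i (measurableSet_singleton ρ))
    (hw.measurable_holding i) measurable_const

lemma measurable_awayTime (hw : IsSkeleton G ρ P Y S) (k : ℕ) :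
    Measurable fun ω => awayTime ρ T (fun i => Y i ω) (fun i => S i ω) k := by
  refine Finset.measurable_fun_sum _ fun i _ => ?_
  refine Measurable.ite (MeasurableSet.inter ?_ ?_) (hw.measurable_holding i) measurable_const
  · exact (hw.measurable_chain i (measurableSet_singleton ρ)).compl
  · exact measurableSet_lt (hw.measurable_rootTime i) measurable_const

variable [IsProbabilityMeasure P]

/-- Both clocks at step `k` use only holding times before `k`, so `lintegral_step` applies: the new
holding time belongs to the vertex being left. -/
theorem lintegral_state_succ (hw : IsSkeleton G ρ P Y S) (F : V → ℝ → ℝ → ℝ≥0∞)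
    (hF : ∀ v, Measurable fun p : ℝ × ℝ => F v p.1 p.2) (k : ℕ) :
    ∫⁻ ω, F (Y (k + 1) ω) (rootTime ρ (fun i => Y i ω) (fun i => S i ω) (k + 1))
        (awayTime ρ T (fun i => Y i ω) (fun i => S i ω) (k + 1)) ∂P =
      ∫⁻ ω, stepMean G ρ T F (Y k ω) (rootTime ρ (fun i => Y i ω) (fun i => S i ω) k)
        (awayTime ρ T (fun i => Y i ω) (fun i => S i ω) k) ∂P := by
  simp_rw [rootTime_succ, awayTime_succ]
  refine hw.lintegral_step k (fun y s w x => F w (rootTime ρ y s k + if y k = ρ then x else 0)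
    (awayTime ρ T y s k + if y k ≠ ρ ∧ rootTime ρ y s k < T then x else 0)) ?_ ?_
  · intro y w
    have h1 : Measurable fun p : (ℕ → ℝ) × ℝ => rootTime ρ y p.1 k :=
      (_root_.measurable_rootTime ρ y k).comp measurable_fst
    have h2 : Measurable fun p : (ℕ → ℝ) × ℝ => awayTime ρ T y p.1 k :=
      (_root_.measurable_awayTime ρ T y k).comp measurable_fst
    refine (hF w).comp (Measurable.prodMk (h1.add ?_) (h2.add ?_))
    · split_ifs <;> fun_prop
    · by_cases hy : y k = ρ
      · simp [hy]
      · simp only [ne_eq, hy, not_false_eq_true, true_and]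
        exact Measurable.ite (measurableSet_lt h1 measurable_const) measurable_snd
          measurable_const
  · intro y y' s s' hy hs
    have hy' : ∀ i < k, y i = y' i := fun i hi => hy i hi.le
    funext w x
    rw [rootTime_congr ρ hy' hs, awayTime_congr ρ T hy' hs, hy k le_rfl]

theorem lintegral_meanPotential (hw : IsSkeleton G ρ P Y S)
    (H : IsHittingPotential G ρ h q c K) {α : ℝ} (hα : 0 ≤ α) (hα1 : α ≤ 1) (k : ℕ) :
    ∫⁻ ω, ENNReal.ofReal (meanPotential h c T α (Y k ω)
        (rootTime ρ (fun i => Y i ω) (fun i => S i ω) k)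
        (awayTime ρ T (fun i => Y i ω) (fun i => S i ω) k)) ∂P +
      ∑ i ∈ Finset.range k, ∫⁻ ω, ENNReal.ofReal
        (if rootTime ρ (fun i => Y i ω) (fun i => S i ω) i < T then α else 0) ∂P =
      ENNReal.ofReal (meanPotential h c T α ρ 0 0) := by
  induction k with
  | zero =>
    simp only [rootTime, awayTime, Finset.range_zero, Finset.sum_empty, add_zero]
    rw [lintegral_congr_ae (g := fun _ => ENNReal.ofReal (meanPotential h c T α ρ 0 0))]
    · simp
    · filter_upwards [hw.ae_start] with ω hω
      rw [hω]
  | succ k ih =>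
    rw [← ih, hw.lintegral_state_succ (fun v a d => ENNReal.ofReal (meanPotential h c T α v a d))
      fun v => (measurable_meanPotential h c T α v).ennreal_ofReal, Finset.sum_range_succ,
      add_comm (∑ i ∈ Finset.range k, _), ← add_assoc, ← lintegral_add_right]
    · congr 1
      refine lintegral_congr_ae ?_
      filter_upwards [hw.ae_holding_nonneg] with ω hω
      exact H.stepMean_meanPotential hα hα1 _ _ (awayTime_nonneg ρ T _ hω k)
    · exact (Measurable.ite (measurableSet_lt (hw.measurable_rootTime k) measurable_const)
        measurable_const measurable_const).ennreal_ofReal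

theorem lintegral_sqPotential_le (hw : IsSkeleton G ρ P Y S)
    (H : IsHittingPotential G ρ h q c K) (k : ℕ) :
    ∫⁻ ω, ENNReal.ofReal (sqPotential h q c K T (Y k ω)
        (rootTime ρ (fun i => Y i ω) (fun i => S i ω) k)
        (awayTime ρ T (fun i => Y i ω) (fun i => S i ω) k)) ∂P ≤
      ENNReal.ofReal (sqPotential h q c K T ρ 0 0) := by
  induction k with
  | zero =>
    simp only [rootTime, awayTime, Finset.range_zero, Finset.sum_empty]
    rw [lintegral_congr_ae (g := fun _ => ENNReal.ofReal (sqPotential h q c K T ρ 0 0))]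
    · simp
    · filter_upwards [hw.ae_start] with ω hω
      rw [hω]
  | succ k ih =>
    refine le_trans ?_ ih
    rw [hw.lintegral_state_succ (fun v a d => ENNReal.ofReal (sqPotential h q c K T v a d))
      fun v => (measurable_sqPotential h q c K T v).ennreal_ofReal]
    refine lintegral_mono_ae ?_
    filter_upwards [hw.ae_holding_nonneg] with ω hω
    exact H.stepMean_sqPotential_le _ _ (awayTime_nonneg ρ T _ hω k)

/-- The potential with `α = 1` is nonnegative and loses `P(root time < T)` in mean at each step, so
these probabilities are summable. -/
theorem tendsto_measure_rootTime_lt (hw : IsSkeleton G ρ P Y S)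
    (H : IsHittingPotential G ρ h q c K) (T : ℝ) :
    Tendsto (fun k => P {ω | rootTime ρ (fun i => Y i ω) (fun i => S i ω) k < T}) atTop
      (𝓝 0) := by
  refine ENNReal.tendsto_atTop_zero_of_tsum_ne_top ?_
  refine ne_top_of_le_ne_top (ENNReal.ofReal_ne_top (r := meanPotential h c T 1 ρ 0 0)) ?_
  rw [ENNReal.tsum_eq_iSup_nat]
  refine iSup_le fun k => ?_
  rw [← hw.lintegral_meanPotential H zero_le_one le_rfl k]
  refine le_trans (le_of_eq (Finset.sum_congr rfl fun i _ => ?_)) le_add_self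
  have hm : MeasurableSet {ω | rootTime ρ (fun i => Y i ω) (fun i => S i ω) i < T} :=
    measurableSet_lt (hw.measurable_rootTime i) measurable_const
  rw [← lintegral_indicator_one hm]
  refine lintegral_congr fun ω => ?_
  by_cases hω : rootTime ρ (fun i => Y i ω) (fun i => S i ω) i < T <;> simp [hω]

theorem ae_exists_le_rootTime (hw : IsSkeleton G ρ P Y S)
    (H : IsHittingPotential G ρ h q c K) (T : ℝ) :
    ∀ᵐ ω ∂P, ∃ k, T ≤ rootTime ρ (fun i => Y i ω) (fun i => S i ω) k := by
  rw [ae_iff]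
  refine le_antisymm (ge_of_tendsto' (hw.tendsto_measure_rootTime_lt H T) fun k => ?_) zero_le
  refine measure_mono fun ω hω => ?_
  simp only [not_exists, not_le, Set.mem_ofPred_eq] at hω ⊢
  exact hω k

/-- The total time spent away from `ρ` before the time spent at `ρ` reaches `T`. -/
def totalAwayTime (ρ : V) (T : ℝ) (Y : ℕ → Ω → V) (S : ℕ → Ω → ℝ) (ω : Ω) : ℝ≥0∞ :=
  ⨆ k, ENNReal.ofReal (awayTime ρ T (fun i => Y i ω) (fun i => S i ω) k)

omit [IsProbabilityMeasure P] in
lemma measurable_totalAwayTime (hw : IsSkeleton G ρ P Y S) :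
    Measurable (totalAwayTime ρ T Y S) :=
  Measurable.iSup fun k => (hw.measurable_awayTime k).ennreal_ofReal

omit [IsProbabilityMeasure P] in
lemma tendsto_lintegral_awayTime_pow (hw : IsSkeleton G ρ P Y S) (p : ℕ) :
    Tendsto (fun k => ∫⁻ ω, ENNReal.ofReal
        (awayTime ρ T (fun i => Y i ω) (fun i => S i ω) k) ^ p ∂P) atTop
      (𝓝 (∫⁻ ω, totalAwayTime ρ T Y S ω ^ p ∂P)) := by
  refine lintegral_tendsto_of_tendsto_of_monotone
    (fun k => ((hw.measurable_awayTime k).ennreal_ofReal.pow_const p).aemeasurable) ?_ ?_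
  · filter_upwards [hw.ae_holding_nonneg] with ω hω k l hkl
    exact pow_le_pow_left' (ENNReal.ofReal_le_ofReal (monotone_awayTime ρ T _ hω hkl)) p
  · filter_upwards [hw.ae_holding_nonneg] with ω hω
    exact ((ENNReal.continuous_pow p).tendsto _).comp (tendsto_atTop_iSup fun k l hkl =>
      ENNReal.ofReal_le_ofReal (monotone_awayTime ρ T _ hω hkl))

/-- The martingale splits into the away time so far, which increases to the total, and a remainder
that is bounded and supported on the event that the root time is below `T`, whose probability tends
to 0. -/
theorem lintegral_totalAwayTime (hw : IsSkeleton G ρ P Y S)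
    (H : IsHittingPotential G ρ h q c K) (hT : 0 ≤ T) :
    ∫⁻ ω, totalAwayTime ρ T Y S ω ∂P = ENNReal.ofReal (c * T) := by
  have hc := H.nonneg_root
  have h0 : meanPotential h c T 0 ρ 0 0 = c * T := by
    rcases hT.eq_or_lt with rfl | hT
    · simp [meanPotential]
    · simp [meanPotential, hT, H.root]
  let A : ℕ → Ω → ℝ := fun k ω => rootTime ρ (fun i => Y i ω) (fun i => S i ω) k
  let e : ℕ → Ω → ℝ := fun k ω =>
    if A k ω < T then h (Y k ω) + c * (T - A k ω) else 0
  have hsplit : ∀ k, ∫⁻ ω, ENNReal.ofReal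
      (awayTime ρ T (fun i => Y i ω) (fun i => S i ω) k) ∂P + ∫⁻ ω, ENNReal.ofReal (e k ω) ∂P =
      ENNReal.ofReal (c * T) := by
    intro k
    rw [← h0, ← hw.lintegral_meanPotential H le_rfl zero_le_one k,
      ← lintegral_add_left (hw.measurable_awayTime k).ennreal_ofReal]
    simp only [ite_self, ENNReal.ofReal_zero, lintegral_zero, Finset.sum_const_zero, add_zero]
    refine lintegral_congr_ae ?_
    filter_upwards [hw.ae_holding_nonneg] with ω hω
    rw [← ENNReal.ofReal_add (awayTime_nonneg ρ T _ hω k)]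
    · simp only [e, A, meanPotential, sub_zero, one_mul, add_zero]
    · simp only [e]
      split_ifs with hlt
      · exact add_nonneg (H.nonneg _) (mul_nonneg hc (sub_pos.2 hlt).le)
      · exact le_rfl
  have hbound : ∀ k, ∫⁻ ω, ENNReal.ofReal (e k ω) ∂P ≤
      ENNReal.ofReal (∑ v, h v + c * T) * P {ω | A k ω < T} := by
    intro k
    have hm : MeasurableSet {ω | A k ω < T} :=
      measurableSet_lt (hw.measurable_rootTime k) measurable_const
    rw [← lintegral_indicator_const hm]
    refine lintegral_mono_ae ?_
    filter_upwards [hw.ae_holding_nonneg] with ω hω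
    have hA : 0 ≤ A k ω := Finset.sum_nonneg fun i _ => by split_ifs <;> simp [hω]
    by_cases hlt : A k ω < T
    · rw [Set.indicator_of_mem (by exact hlt)]
      simp only [e, hlt, if_true]
      refine ENNReal.ofReal_le_ofReal (add_le_add ?_ ?_)
      · exact Finset.single_le_sum (fun v _ => H.nonneg v) (Finset.mem_univ _)
      · exact mul_le_mul_of_nonneg_left (by linarith) hc
    · simp [e, hlt]
  have hlim : Tendsto (fun k => ∫⁻ ω, ENNReal.ofReal (e k ω) ∂P) atTop (𝓝 0) := by
    refine tendsto_of_tendsto_of_tendsto_of_le_of_le tendsto_const_nhds ?_ (fun _ => zero_le)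
      hbound
    have := ENNReal.Tendsto.const_mul (a := ENNReal.ofReal (∑ v, h v + c * T))
      (hw.tendsto_measure_rootTime_lt H T) (Or.inr ENNReal.ofReal_ne_top)
    simpa using this
  have h1 := hw.tendsto_lintegral_awayTime_pow (T := T) 1
  simp only [pow_one] at h1
  have h2 := h1.add hlim
  simp only [hsplit, add_zero] at h2
  exact tendsto_nhds_unique h2 tendsto_const_nhds

/-- The potential dominates the squared away time, so the supermartingale bound passes to the limit
by monotone convergence; no remainder has to be controlled. -/
theorem lintegral_totalAwayTime_sq_le (hw : IsSkeleton G ρ P Y S)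
    (H : IsHittingPotential G ρ h q c K) (hT : 0 ≤ T) :
    ∫⁻ ω, totalAwayTime ρ T Y S ω ^ 2 ∂P ≤ ENNReal.ofReal ((c * T) ^ 2 + K * T) := by
  have hc := H.nonneg_root
  have hK := H.sq_nonneg_root
  have h0 : sqPotential h q c K T ρ 0 0 = (c * T) ^ 2 + K * T := by
    rcases hT.eq_or_lt with rfl | hT
    · simp [sqPotential]
    · simp [sqPotential, hT, H.root, H.sq_root]
  rw [← h0]
  refine le_of_tendsto' (hw.tendsto_lintegral_awayTime_pow 2) fun k => ?_
  refine le_trans (lintegral_mono_ae ?_) (hw.lintegral_sqPotential_le H k)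
  filter_upwards [hw.ae_holding_nonneg] with ω hω
  have hd := awayTime_nonneg ρ T (fun i => Y i ω) hω k
  rw [← ENNReal.ofReal_pow hd]
  refine ENNReal.ofReal_le_ofReal ?_
  unfold sqPotential
  refine le_add_of_nonneg_right ?_
  have := H.nonneg (Y k ω)
  have := H.sq_nonneg (Y k ω)
  split_ifs with hlt
  · have := sub_pos.2 hlt
    positivity
  · exact le_rfl

end IsSkeleton

/-- Mean and variance of a shifted nonnegative random variable from bounds on its moments. -/
theorem moments_const_add {P : Measure Ω} [IsProbabilityMeasure P] {Z : Ω → ℝ≥0∞}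
    (hZ : Measurable Z) {m b T : ℝ} (hT : 0 ≤ T) (hm : 0 ≤ m) (hb : 0 ≤ b)
    (h1 : ∫⁻ ω, Z ω ∂P = ENNReal.ofReal m)
    (h2 : ∫⁻ ω, Z ω ^ 2 ∂P ≤ ENNReal.ofReal (m ^ 2 + b)) {τ : Ω → ℝ≥0∞}
    (hτ : ∀ᵐ ω ∂P, τ ω = ENNReal.ofReal T + Z ω) :
    (∀ᵐ ω ∂P, τ ω < ∞) ∧ MemLp (fun ω => (τ ω).toReal) 2 P ∧
      P[fun ω => (τ ω).toReal] = T + m ∧ Var[fun ω => (τ ω).toReal; P] ≤ b := by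
  have hfin : ∀ᵐ ω ∂P, Z ω < ∞ := ae_lt_top hZ (by rw [h1]; exact ENNReal.ofReal_ne_top)
  have hae : (fun ω => (τ ω).toReal) =ᵐ[P] fun ω => T + (Z ω).toReal := by
    filter_upwards [hτ, hfin] with ω h3 h4
    rw [h3, ENNReal.toReal_add ENNReal.ofReal_ne_top h4.ne, ENNReal.toReal_ofReal hT]
  have hsq : ∫⁻ ω, ENNReal.ofReal ((Z ω).toReal ^ 2) ∂P = ∫⁻ ω, Z ω ^ 2 ∂P := by
    refine lintegral_congr_ae ?_
    filter_upwards [hfin] with ω h4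
    rw [ENNReal.ofReal_pow ENNReal.toReal_nonneg, ENNReal.ofReal_toReal h4.ne]
  have hmeas : Measurable fun ω => (Z ω).toReal := hZ.ennreal_toReal
  have hLp : MemLp (fun ω => (Z ω).toReal) 2 P := by
    rw [memLp_two_iff_integrable_sq hmeas.aestronglyMeasurable]
    refine ⟨(hmeas.pow_const 2).aestronglyMeasurable, ?_⟩
    rw [hasFiniteIntegral_iff_ofReal (ae_of_all _ fun ω => sq_nonneg _), hsq]
    exact h2.trans_lt ENNReal.ofReal_lt_top
  have hmean : ∫ ω, (Z ω).toReal ∂P = m := by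
    rw [integral_toReal hZ.aemeasurable hfin, h1, ENNReal.toReal_ofReal hm]
  have hvar : Var[fun ω => (Z ω).toReal; P] ≤ b := by
    -- As the mean is exactly `m`, its square cancels and an upper bound on the second moment
    -- suffices.
    rw [variance_eq_sub hLp, hmean]
    have : P[(fun ω => (Z ω).toReal) ^ 2] ≤ m ^ 2 + b := by
      have h5 := integral_eq_lintegral_of_nonneg_ae (μ := P) (f := (fun ω => (Z ω).toReal) ^ 2)
        (ae_of_all _ fun ω => sq_nonneg _) (hmeas.pow_const 2).aestronglyMeasurable
      rw [h5]
      refine ENNReal.toReal_le_of_le_ofReal (by positivity) ?_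
      exact hsq.le.trans h2
    linarith
  refine ⟨?_, ?_, ?_, ?_⟩
  · filter_upwards [hτ, hfin] with ω h3 h4
    rw [h3]
    exact ENNReal.add_lt_top.2 ⟨ENNReal.ofReal_lt_top, h4⟩
  · exact (memLp_congr_ae hae).2 ((memLp_const T).add hLp)
  · rw [integral_congr_ae hae, integral_add (integrable_const T) (hLp.integrable one_le_two)]
    simp [hmean]
  · rw [variance_congr hae, variance_const_add hmeas.aestronglyMeasurable]
    exact hvar

end Moments

/-! ### The inverse local time along a path -/

section Path

variable {V Ω : Type*} [DecidableEq V]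

/-- The path is constant on each holding interval. The right endpoint is allowed for `u`, where the
path may already have jumped, because comparing integrands on open intervals is enough; the
induction uses this endpoint. -/
lemma integral_indicator_path {ρ : V} {y : ℕ → V} {s : ℕ → ℝ} (hs : ∀ i, 0 ≤ s i) {x : ℝ≥0 → V}
    (hx : ∀ (k : ℕ) (t : ℝ≥0), ∑ i ∈ Finset.range k, s i ≤ (t : ℝ) →
      (t : ℝ) < ∑ i ∈ Finset.range (k + 1), s i → x t = y k) (k : ℕ) {u : ℝ}
    (hu : ∑ i ∈ Finset.range k, s i ≤ u) (hu' : u ≤ ∑ i ∈ Finset.range (k + 1), s i) :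
    IntervalIntegrable (fun r => if x r.toNNReal = ρ then (1 : ℝ) else 0) volume 0 u ∧
      ∫ r in (0 : ℝ)..u, (if x r.toNNReal = ρ then (1 : ℝ) else 0) =
        rootTime ρ y s k + if y k = ρ then u - ∑ i ∈ Finset.range k, s i else 0 := by
  have hpiece : ∀ (k : ℕ) (u : ℝ), ∑ i ∈ Finset.range k, s i ≤ u →
      u ≤ ∑ i ∈ Finset.range (k + 1), s i →
      Set.EqOn (fun _ => if y k = ρ then (1 : ℝ) else 0)
        (fun r => if x r.toNNReal = ρ then (1 : ℝ) else 0)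
        (Set.uIoo (∑ i ∈ Finset.range k, s i) u) := by
    intro k u hu hu' r hr
    rw [Set.uIoo_of_le hu] at hr
    have hr0 : 0 ≤ r := (Finset.sum_nonneg fun i _ => hs i).trans hr.1.le
    have := hx k r.toNNReal (by rw [Real.coe_toNNReal r hr0]; exact hr.1.le)
      (by rw [Real.coe_toNNReal r hr0]; exact hr.2.trans_le hu')
    simp only [this]
  induction k generalizing u with
  | zero =>
    have hp := hpiece 0 u hu hu'
    simp only [Finset.range_zero, Finset.sum_empty] at hp hu
    refine ⟨(intervalIntegrable_const (c := if y 0 = ρ then (1 : ℝ) else 0)).congr_uIoo hp, ?_⟩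
    rw [← intervalIntegral.integral_congr_uIoo hp]
    simp [rootTime]
  | succ k ih =>
    obtain ⟨h1, h2⟩ := ih (u := ∑ i ∈ Finset.range (k + 1), s i)
      (by rw [Finset.sum_range_succ]; exact le_add_of_nonneg_right (hs k)) le_rfl
    have hp := hpiece (k + 1) u hu hu'
    have h3 := (intervalIntegrable_const (c := if y (k + 1) = ρ then (1 : ℝ) else 0)
      (μ := volume)).congr_uIoo hp
    refine ⟨h1.trans h3, ?_⟩
    rw [← intervalIntegral.integral_add_adjacent_intervals h1 h3, h2,
      ← intervalIntegral.integral_congr_uIoo hp, rootTime_succ]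
    congr 1
    · congr 1
      split_ifs
      · rw [Finset.sum_range_succ]; ring
      · rfl
    · simp

lemma awayTime_add_rootTime {ρ : V} {T : ℝ} {y : ℕ → V} {s : ℕ → ℝ} {k : ℕ}
    (hk : ∀ i < k, rootTime ρ y s i < T) :
    awayTime ρ T y s k + rootTime ρ y s k = ∑ i ∈ Finset.range k, s i := by
  rw [awayTime, rootTime, ← Finset.sum_add_distrib]
  refine Finset.sum_congr rfl fun i hi => ?_
  by_cases hy : y i = ρ <;> simp [hy, hk i (Finset.mem_range.1 hi)]

/-- The level `T` is crossed during a visit to the root, at the instant when the elapsed time is `T`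
plus the away time so far. This happens within finitely many visits, so no non-explosion argument is
needed. -/
theorem inverseLocalTime_eq [Fintype V] {G : SimpleGraph V} [DecidableRel G.Adj] {ρ : V}
    (hρ : 0 < G.degree ρ) {X : ℝ≥0 → Ω → V} {ω : Ω} {y : ℕ → V} {s : ℕ → ℝ} (hs : ∀ i, 0 ≤ s i)
    (hx : ∀ (k : ℕ) (t : ℝ≥0), ∑ i ∈ Finset.range k, s i ≤ (t : ℝ) →
      (t : ℝ) < ∑ i ∈ Finset.range (k + 1), s i → X t ω = y k) {t : ℝ} (ht : 0 ≤ t)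
    (hex : ∃ k, G.degree ρ * t ≤ rootTime ρ y s k) :
    inverseLocalTime G X ρ t ω = ENNReal.ofReal (G.degree ρ * t) +
      ⨆ k, ENNReal.ofReal (awayTime ρ (G.degree ρ * t) y s k) := by
  classical
  have hd : (0 : ℝ) < G.degree ρ := Nat.cast_pos.2 hρ
  set T : ℝ := G.degree ρ * t with hT
  have hT0 : 0 ≤ T := by positivity
  have hroot0 : ∀ k, 0 ≤ rootTime ρ y s k := fun k =>
    Finset.sum_nonneg fun i _ => by split_ifs <;> simp [hs]
  have hloc : ∀ u : ℝ≥0, t ≤ localTime G X ρ u ω ↔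
      T ≤ ∫ r in (0 : ℝ)..u, if X r.toNNReal ω = ρ then (1 : ℝ) else 0 := by
    intro u
    rw [localTime, one_div, le_inv_mul_iff₀ hd]
  obtain ⟨k₀, hk₀, hmin⟩ : ∃ k, T ≤ rootTime ρ y s k ∧ ∀ i < k, rootTime ρ y s i < T :=
    ⟨Nat.find hex, Nat.find_spec hex, fun i hi => not_le.1 (Nat.find_min hex hi)⟩
  have hlate : ∀ i, k₀ ≤ i → ¬ rootTime ρ y s i < T := fun i hi =>
    not_lt.2 (hk₀.trans (monotone_rootTime ρ y hs hi))
  unfold inverseLocalTime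
  -- The index 0 occurs only for `T = 0`; otherwise visit `K = k₀ - 1` is the one during which `T`
  -- is reached.
  cases k₀ with
  | zero =>
    have hT' : T = 0 := le_antisymm (by simpa [rootTime] using hk₀) hT0
    have h1 : ∀ k, awayTime ρ T y s k = 0 := fun k =>
      Finset.sum_eq_zero fun i _ => if_neg fun h => hlate i (Nat.zero_le i) h.2
    simp only [h1]
    simp only [hT', ENNReal.ofReal_zero, ciSup_const, add_zero]
    refine le_antisymm (iInf₂_le_of_le 0 ?_ (by simp)) zero_le
    rw [hloc, hT']
    simp
  | succ K =>
    have hK : rootTime ρ y s K < T := hmin K (Nat.lt_succ_self K)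
    have hyK : y K = ρ := by
      by_contra hne
      rw [rootTime_succ, if_neg hne, add_zero] at hk₀
      exact absurd hK (not_lt.2 hk₀)
    rw [rootTime_succ, if_pos hyK] at hk₀
    set J := ∑ i ∈ Finset.range K, s i with hJ
    have hJ1 : ∑ i ∈ Finset.range (K + 1), s i = J + s K := Finset.sum_range_succ _ _
    have hJ0 : 0 ≤ J := Finset.sum_nonneg fun i _ => hs i
    have hD : awayTime ρ T y s K + rootTime ρ y s K = J :=
      awayTime_add_rootTime fun i hi => hmin i (hi.trans (Nat.lt_succ_self K))
    have hDK : ∀ k, K ≤ k → awayTime ρ T y s k = awayTime ρ T y s K := by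
      intro k hk
      induction k, hk using Nat.le_induction with
      | base => rfl
      | succ k hk ih =>
        rw [awayTime_succ, ih, if_neg, add_zero]
        rintro ⟨h1, h2⟩
        rcases hk.eq_or_lt with rfl | hk
        · exact h1 hyK
        · exact hlate k hk h2
    have hsup : ⨆ k, ENNReal.ofReal (awayTime ρ T y s k) =
        ENNReal.ofReal (awayTime ρ T y s K) := by
      refine le_antisymm (iSup_le fun k => ENNReal.ofReal_le_ofReal ?_) (le_iSup_of_le K le_rfl)
      rw [← hDK (max k K) (le_max_right _ _)]
      exact monotone_awayTime ρ T y hs (le_max_left _ _)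
    rw [hsup, ← ENNReal.ofReal_add hT0 (awayTime_nonneg ρ T y hs K)]
    set u₀ := T + awayTime ρ T y s K with hu₀
    have hu1 : J ≤ u₀ := by linarith
    have hu2 : u₀ ≤ ∑ i ∈ Finset.range (K + 1), s i := by linarith
    have hu0 : 0 ≤ u₀ := hJ0.trans hu1
    refine le_antisymm ?_ (le_iInf₂ fun u hu => ?_)
    · refine iInf₂_le_of_le u₀.toNNReal ?_ le_rfl
      rw [hloc, Real.coe_toNNReal _ hu0, (integral_indicator_path hs hx K hu1 hu2).2, if_pos hyK]
      linarith
    · rw [hloc] at hu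
      refine ENNReal.ofReal_le_of_le_toReal ?_
      rw [ENNReal.coe_toReal]
      by_contra! hlt
      rcases le_or_gt J u with hJu | hJu
      · rw [(integral_indicator_path hs hx K hJu (hlt.le.trans hu2)).2, if_pos hyK] at hu
        linarith
      -- Before visit `K` begins, the time at the root is at most `rootTime ρ y s K`, which is less
      -- than `T`.
      · obtain ⟨h1, h2⟩ := integral_indicator_path (ρ := ρ) hs hx K le_rfl (hu1.trans hu2)
        have h3 := intervalIntegral.integral_mono_interval le_rfl u.2 hJu.le
          (ae_of_all _ fun r => by split_ifs <;> simp) h1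
        rw [h2, sub_self, ite_self, add_zero] at h3
        exact absurd (hu.trans h3) (not_le.2 hK)

end Path

/-! ### Moments of the inverse local time of a random walk -/

section InverseLocalTime

variable {V Ω : Type*} [Fintype V] [DecidableEq V] {G : SimpleGraph V} [DecidableRel G.Adj]
  {ρ : V} {h q : V → ℝ} {c K : ℝ}

/-- By reversibility, the mean return time to `ρ` determines the number of edges. -/
theorem IsHittingPotential.two_mul_card_edgeFinset (H : IsHittingPotential G ρ h q c K)
    (hdeg : ∀ v, 0 < G.degree v) :
    2 * (G.edgeFinset.card : ℝ) = G.degree ρ * (1 + c) := by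
  have hp : ∀ v w, (G.degree v : ℝ) * stepProb G v w = if G.Adj v w then 1 else 0 := by
    intro v w
    have : (G.degree v : ℝ) ≠ 0 := Nat.cast_ne_zero.2 (hdeg v).ne'
    unfold stepProb
    split_ifs <;> simp [this]
  have hsum : ∀ v, (G.degree v : ℝ) * ∑ w, stepProb G v w * h w =
      G.degree v * h v - G.degree v + if v = ρ then G.degree v * (1 + c) else 0 := by
    intro v
    by_cases hv : v = ρ
    · subst hv
      rw [H.step_root, H.root, if_pos rfl]; ring
    · rw [H.step v hv, if_neg hv]; ring
  -- The degree measure is stationary. Since a step changes `h` in mean by `-1` off the root and by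
  -- `c` at the root, comparing both sides yields the edge count.
  have h1 : ∑ v, (G.degree v : ℝ) * ∑ w, stepProb G v w * h w = ∑ v, G.degree v * h v := by
    calc ∑ v, (G.degree v : ℝ) * ∑ w, stepProb G v w * h w
        = ∑ v, ∑ w, (if G.Adj v w then (1 : ℝ) else 0) * h w := by
          refine Finset.sum_congr rfl fun v _ => ?_
          rw [Finset.mul_sum]
          exact Finset.sum_congr rfl fun w _ => by rw [← mul_assoc, hp]
      _ = ∑ w, ∑ v, (if G.Adj v w then (1 : ℝ) else 0) * h w := Finset.sum_comm
      _ = ∑ w, G.degree w * h w := by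
          refine Finset.sum_congr rfl fun w _ => ?_
          rw [← Finset.sum_mul]
          congr 1
          simp_rw [G.adj_comm _ w, ← hp w]
          rw [← Finset.mul_sum, H.sum_stepProb, mul_one]
  simp_rw [hsum, Finset.sum_add_distrib, Finset.sum_sub_distrib] at h1
  have h2 : ∑ v, (G.degree v : ℝ) = 2 * (G.edgeFinset.card : ℝ) := by
    exact_mod_cast G.sum_degrees_eq_twice_card_edges
  rw [h2, Finset.sum_ite_eq' Finset.univ ρ, if_pos (Finset.mem_univ ρ)] at h1
  linarith

theorem inverseLocalTime_moments [MeasurableSpace V] [MeasurableSingletonClass V]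
    [MeasurableSpace Ω] {P : Measure Ω} [IsProbabilityMeasure P]
    (H : IsHittingPotential G ρ h q c K) (hdeg : ∀ v, 0 < G.degree v) {X : ℝ≥0 → Ω → V}
    (hX : IsRandomWalk G ρ P X) {t : ℝ} (ht : 0 ≤ t) :
    (∀ᵐ ω ∂P, inverseLocalTime G X ρ t ω < ∞) ∧
      MemLp (fun ω => (inverseLocalTime G X ρ t ω).toReal) 2 P ∧
      P[fun ω => (inverseLocalTime G X ρ t ω).toReal] = 2 * (G.edgeFinset.card : ℝ) * t ∧
      Var[fun ω => (inverseLocalTime G X ρ t ω).toReal; P] ≤ K * (G.degree ρ * t) := by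
  obtain ⟨Y, S, hY, hlaw, hS, hSlaw, hSind, hind, hpath⟩ := hX
  have hw : IsSkeleton G ρ P Y S := ⟨hY, hlaw, hS, hSlaw, hSind, hind⟩
  have hT : 0 ≤ (G.degree ρ : ℝ) * t := by positivity
  have hτ : ∀ᵐ ω ∂P, inverseLocalTime G X ρ t ω = ENNReal.ofReal (G.degree ρ * t) +
      IsSkeleton.totalAwayTime ρ (G.degree ρ * t) Y S ω := by
    filter_upwards [hw.ae_holding_nonneg, hw.ae_exists_le_rootTime H (G.degree ρ * t), hpath]
      with ω h1 h2 h3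
    exact inverseLocalTime_eq (hdeg ρ) h1 h3 ht h2
  obtain ⟨h1, h2, h3, h4⟩ := moments_const_add hw.measurable_totalAwayTime hT
    (mul_nonneg H.nonneg_root hT) (mul_nonneg H.sq_nonneg_root hT)
    (hw.lintegral_totalAwayTime H hT) (hw.lintegral_totalAwayTime_sq_le H hT) hτ
  refine ⟨h1, h2, ?_, h4⟩
  rw [h3, H.two_mul_card_edgeFinset hdeg]
  ring

end InverseLocalTime

/-! ### The hitting potential of the binary tree -/

section Tree

variable {n : ℕ}

lemma sum_stepProb_mul {V : Type*} [Fintype V] {G : SimpleGraph V} [DecidableRel G.Adj] (v : V)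
    (f : V → ℝ) :
    ∑ w, stepProb G v w * f w = (G.degree v : ℝ)⁻¹ * ∑ w ∈ G.neighborFinset v, f w := by
  rw [Finset.mul_sum, G.neighborFinset_eq_filter, Finset.sum_filter]
  refine Finset.sum_congr rfl fun w _ => ?_
  unfold stepProb
  split_ifs <;> simp

lemma binaryTree_adj {u v : TreeVertex n} : (binaryTree n).Adj u v ↔
    (∃ b : Bool, v.1 = b :: u.1) ∨ (∃ b : Bool, u.1 = b :: v.1) := Iff.rfl

lemma binaryTree_neighborFinset_root (hn : 1 ≤ n) :
    (binaryTree n).neighborFinset (treeRoot n) = {⟨[true], hn⟩, ⟨[false], hn⟩} := by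
  ext ⟨w, hw⟩
  rw [SimpleGraph.mem_neighborFinset, binaryTree_adj]
  simp [treeRoot, or_comm]

lemma binaryTree_neighborFinset_leaf {b : Bool} {w : List Bool} (hw : (b :: w).length = n) :
    (binaryTree n).neighborFinset ⟨b :: w, hw.le⟩ =
      {⟨w, (Nat.le_succ _).trans hw.le⟩} := by
  ext ⟨u, hu⟩
  simp only [SimpleGraph.mem_neighborFinset, binaryTree_adj, Finset.mem_singleton, Subtype.mk.injEq]
  constructor
  · rintro (⟨b', rfl⟩ | ⟨b', h⟩)
    · simp only [List.length_cons] at hu hw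
      omega
    · exact (List.cons.inj h).2.symm
  · rintro rfl
    exact Or.inr ⟨b, rfl⟩

lemma binaryTree_neighborFinset_inner {b : Bool} {w : List Bool} (hw : (b :: w).length < n) :
    (binaryTree n).neighborFinset ⟨b :: w, hw.le⟩ =
      {⟨true :: b :: w, hw⟩, ⟨false :: b :: w, hw⟩, ⟨w, (Nat.le_succ _).trans hw.le⟩} := by
  ext ⟨u, hu⟩
  simp only [SimpleGraph.mem_neighborFinset, binaryTree_adj, Finset.mem_singleton,
    Finset.mem_insert, Subtype.mk.injEq]
  constructor
  · rintro (⟨b', rfl⟩ | ⟨b', h⟩)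
    · cases b' <;> simp
    · exact Or.inr (Or.inr (List.cons.inj h).2.symm)
  · rintro (rfl | rfl | rfl)
    · exact Or.inl ⟨true, rfl⟩
    · exact Or.inl ⟨false, rfl⟩
    · exact Or.inr ⟨b, rfl⟩

lemma binaryTree_degree_root (hn : 1 ≤ n) : (binaryTree n).degree (treeRoot n) = 2 := by
  rw [← SimpleGraph.card_neighborFinset_eq_degree, binaryTree_neighborFinset_root hn]
  rfl

lemma binaryTree_step_root (hn : 1 ≤ n) (f : ℕ → ℝ) :
    ∑ w, stepProb (binaryTree n) (treeRoot n) w * f w.1.length = f 1 := by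
  rw [sum_stepProb_mul _ fun w : TreeVertex n => f w.1.length, binaryTree_degree_root hn,
    binaryTree_neighborFinset_root hn, Finset.sum_pair (by simp)]
  simp
  ring

lemma binaryTree_degree_leaf {b : Bool} {w : List Bool} (hw : (b :: w).length = n) :
    (binaryTree n).degree ⟨b :: w, hw.le⟩ = 1 := by
  rw [← SimpleGraph.card_neighborFinset_eq_degree, binaryTree_neighborFinset_leaf hw,
    Finset.card_singleton]

lemma binaryTree_step_leaf {b : Bool} {w : List Bool} (hw : (b :: w).length = n) (f : ℕ → ℝ) :
    ∑ u, stepProb (binaryTree n) ⟨b :: w, hw.le⟩ u * f u.1.length = f w.length := by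
  rw [sum_stepProb_mul _ fun w : TreeVertex n => f w.1.length, binaryTree_degree_leaf hw,
    binaryTree_neighborFinset_leaf hw, Finset.sum_singleton]
  simp

lemma binaryTree_degree_inner {b : Bool} {w : List Bool} (hw : (b :: w).length < n) :
    (binaryTree n).degree ⟨b :: w, hw.le⟩ = 3 := by
  rw [← SimpleGraph.card_neighborFinset_eq_degree, binaryTree_neighborFinset_inner hw,
    Finset.card_eq_three]
  refine ⟨_, _, _, ?_, ?_, ?_, rfl⟩
  · simp
  · exact fun h => absurd (congrArg (fun u : TreeVertex n => u.1.length) h) (by simp; omega)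
  · exact fun h => absurd (congrArg (fun u : TreeVertex n => u.1.length) h) (by simp; omega)

/-- On functions of the level the walk acts as a birth-death chain. The current level is `w.length +
1`, with two children above it and one parent below. -/
lemma binaryTree_step_inner {b : Bool} {w : List Bool} (hw : (b :: w).length < n) (f : ℕ → ℝ) :
    ∑ u, stepProb (binaryTree n) ⟨b :: w, hw.le⟩ u * f u.1.length =
      (2 * f (w.length + 2) + f w.length) / 3 := by
  have h1 : (⟨true :: b :: w, hw⟩ : TreeVertex n) ∉
      ({⟨false :: b :: w, hw⟩, ⟨w, (Nat.le_succ _).trans hw.le⟩} : Finset (TreeVertex n)) := by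
    simp only [Finset.mem_insert, Finset.mem_singleton, not_or]
    exact ⟨by simp, fun h =>
      absurd (congrArg (fun u : TreeVertex n => u.1.length) h) (by simp; omega)⟩
  have h2 : (⟨false :: b :: w, hw⟩ : TreeVertex n) ∉
      ({⟨w, (Nat.le_succ _).trans hw.le⟩} : Finset (TreeVertex n)) := by
    simp only [Finset.mem_singleton]
    exact fun h => absurd (congrArg (fun u : TreeVertex n => u.1.length) h) (by simp; omega)
  rw [sum_stepProb_mul _ fun w : TreeVertex n => f w.1.length, binaryTree_degree_inner hw,
    binaryTree_neighborFinset_inner hw, Finset.sum_insert h1, Finset.sum_insert h2,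
    Finset.sum_singleton]
  simp only [List.length_cons, Nat.cast_ofNat]
  ring_nf

lemma binaryTree_degree_pos (hn : 1 ≤ n) (v : TreeVertex n) : 0 < (binaryTree n).degree v := by
  obtain ⟨w, hw⟩ := v
  cases w with
  | nil => exact (binaryTree_degree_root hn).symm ▸ Nat.succ_pos 1
  | cons b w =>
    rcases hw.lt_or_eq with h | h
    · rw [binaryTree_degree_inner h]; norm_num
    · rw [binaryTree_degree_leaf h]; norm_num

/-- The mean hitting time of the root from level `l`. -/
def treeHit (n l : ℕ) : ℝ := 4 * 2 ^ n - 4 * 2 ^ (n - l) - 3 * l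

/-- A bound for the second moment of the hitting time of the root from level `l`. -/
def treeHitSq (n l : ℕ) : ℝ := 24 * 2 ^ n * (2 * 2 ^ n - 2 * 2 ^ (n - l) - l)

lemma cast_le_two_pow_sub {l : ℕ} (hl : l ≤ n) : (l : ℝ) ≤ 2 ^ n - 2 ^ (n - l) := by
  obtain ⟨m, rfl⟩ := Nat.exists_eq_add_of_le hl
  rw [Nat.add_sub_cancel_left, pow_add]
  have h1 : ((l + 1 : ℕ) : ℝ) ≤ 2 ^ l := by exact_mod_cast Nat.lt_two_pow_self
  push_cast at h1
  have h2 : (1 : ℝ) ≤ 2 ^ m := one_le_pow₀ one_le_two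
  have h3 : (0 : ℝ) ≤ l := Nat.cast_nonneg l
  nlinarith

lemma treeHit_nonneg {l : ℕ} (hl : l ≤ n) : 0 ≤ treeHit n l := by
  have := cast_le_two_pow_sub hl
  have : (0 : ℝ) ≤ l := Nat.cast_nonneg l
  unfold treeHit
  linarith

lemma treeHitSq_nonneg {l : ℕ} (hl : l ≤ n) : 0 ≤ treeHitSq n l := by
  have := cast_le_two_pow_sub hl
  have : (0 : ℝ) ≤ l := Nat.cast_nonneg l
  exact mul_nonneg (by positivity) (by linarith)

lemma treeHit_le (n l : ℕ) : treeHit n l ≤ 4 * 2 ^ n := by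
  have : (0 : ℝ) ≤ l := Nat.cast_nonneg l
  have : (0 : ℝ) ≤ 2 ^ (n - l) := by positivity
  unfold treeHit
  linarith

/-- At inner vertices `2^(-l)` is harmonic and the level `l` has drift `1/3`. So `-3l` produces the
drift `-1` required of `h`, and the coefficient of `2^(n-l)` is fixed by the equation at the leaves.
For `q`, the bound `h ≤ 4 · 2^n` reduces the requirement to a drift of at most `-8 · 2^n`, which the
same ansatz provides: the bracket in `treeHitSq` has drift `-1/3` inside and `-1` at the leaves, and
the prefactor is `24 · 2^n`. -/
theorem isHittingPotential_binaryTree (hn : 1 ≤ n) :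
    IsHittingPotential (binaryTree n) (treeRoot n) (fun v => treeHit n v.1.length)
      (fun v => treeHitSq n v.1.length) (2 * 2 ^ n - 3) (24 * 2 ^ (2 * n)) where
  sum_stepProb v := by
    have := sum_stepProb_mul (G := binaryTree n) v fun _ => 1
    simp only [mul_one, Finset.sum_const, SimpleGraph.card_neighborFinset_eq_degree,
      nsmul_eq_mul] at this
    rw [this, inv_mul_cancel₀ (Nat.cast_ne_zero.2 (binaryTree_degree_pos hn v).ne')]
  nonneg v := treeHit_nonneg v.2
  root := by simp [treeHit, treeRoot]
  sq_nonneg v := treeHitSq_nonneg v.2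
  sq_root := by simp [treeHitSq, treeRoot]
  step_root := by
    rw [binaryTree_step_root hn (treeHit n)]
    obtain ⟨m, rfl⟩ := Nat.exists_eq_add_of_le' hn
    simp only [treeHit, Nat.add_sub_cancel, pow_succ]
    push_cast
    ring
  sq_step_root := by
    rw [binaryTree_step_root hn (treeHitSq n)]
    obtain ⟨m, rfl⟩ := Nat.exists_eq_add_of_le' hn
    simp only [treeHitSq, Nat.add_sub_cancel, pow_succ, pow_mul']
    have : (0 : ℝ) < 2 ^ m := by positivity
    push_cast
    nlinarith
  step := by
    rintro ⟨w, hw⟩ hv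
    cases w with
    | nil => exact absurd rfl hv
    | cons b w =>
      rcases hw.lt_or_eq with h | h
      · rw [binaryTree_step_inner h (treeHit n)]
        simp only [List.length_cons] at h
        obtain ⟨m, rfl⟩ := Nat.exists_eq_add_of_le (Nat.succ_le_of_lt h)
        have e0 : (w.length + 1).succ + m - w.length = m + 2 := by omega
        have e1 : (w.length + 1).succ + m - (w.length + 1) = m + 1 := by omega
        have e2 : (w.length + 1).succ + m - (w.length + 2) = m := by omega
        simp only [treeHit, List.length_cons, e0, e1, e2, pow_succ (2 : ℝ) m,
          pow_succ (2 : ℝ) (m + 1)]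
        push_cast
        ring
      · rw [binaryTree_step_leaf h (treeHit n)]
        simp only [List.length_cons] at h
        subst h
        simp only [treeHit, List.length_cons, Nat.sub_self, Nat.add_sub_cancel_left]
        push_cast
        ring
  sq_step := by
    rintro ⟨w, hw⟩ hv
    cases w with
    | nil => exact absurd rfl hv
    | cons b w =>
      have hle := treeHit_le n (b :: w).length
      rcases hw.lt_or_eq with h | h
      · rw [binaryTree_step_inner h (treeHitSq n)]
        refine le_trans (le_of_eq ?_)
          (show treeHitSq n (b :: w).length - 8 * 2 ^ n ≤ _ by linarith)
        simp only [List.length_cons] at h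
        obtain ⟨m, rfl⟩ := Nat.exists_eq_add_of_le (Nat.succ_le_of_lt h)
        have e0 : (w.length + 1).succ + m - w.length = m + 2 := by omega
        have e1 : (w.length + 1).succ + m - (w.length + 1) = m + 1 := by omega
        have e2 : (w.length + 1).succ + m - (w.length + 2) = m := by omega
        simp only [treeHitSq, List.length_cons, e0, e1, e2, pow_succ (2 : ℝ) m,
          pow_succ (2 : ℝ) (m + 1)]
        push_cast
        ring
      · rw [binaryTree_step_leaf h (treeHitSq n)]
        have hpos : (0 : ℝ) < 2 ^ n := by positivity
        refine le_trans (le_of_eq ?_)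
          (show treeHitSq n (b :: w).length - 24 * 2 ^ n ≤ _ by linarith)
        simp only [List.length_cons] at h
        subst h
        simp only [treeHitSq, List.length_cons, Nat.sub_self, Nat.add_sub_cancel_left]
        push_cast
        ring

/-- The potential already encodes the edge count: `|E| = 1 + c = 2 · 2^n - 2`. -/
lemma two_pow_le_card_edgeFinset (hn : 1 ≤ n) :
    (2 : ℝ) ^ n ≤ (binaryTree n).edgeFinset.card := by
  have h1 := (isHittingPotential_binaryTree hn).two_mul_card_edgeFinset (binaryTree_degree_pos hn)
  rw [binaryTree_degree_root hn] at h1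
  have h2 : (2 : ℝ) ^ 1 ≤ 2 ^ n := pow_le_pow_right₀ one_le_two hn
  push_cast at h1
  linarith

theorem treeInverseLocalTime_moments {Ω : Type*} [MeasurableSpace Ω] {P : Measure Ω}
    [IsProbabilityMeasure P] (hn : 1 ≤ n) {X : ℝ≥0 → Ω → TreeVertex n}
    (hX : IsRandomWalk (binaryTree n) (treeRoot n) P X) {t : ℝ} (ht : 0 ≤ t) :
    (∀ᵐ ω ∂P, treeInverseLocalTime n X t ω < ∞) ∧
      MemLp (fun ω => (treeInverseLocalTime n X t ω).toReal) 2 P ∧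
      P[fun ω => (treeInverseLocalTime n X t ω).toReal] =
        2 * ((binaryTree n).edgeFinset.card : ℝ) * t ∧
      Var[fun ω => (treeInverseLocalTime n X t ω).toReal; P] ≤ 48 * 2 ^ (2 * n) * t := by
  obtain ⟨h1, h2, h3, h4⟩ := inverseLocalTime_moments (isHittingPotential_binaryTree hn)
    (binaryTree_degree_pos hn) hX ht
  refine ⟨h1, h2, h3, h4.trans (le_of_eq ?_)⟩
  -- The root has degree 2, so the root time is `2t` and the constant is `2 · 24 = 48`.
  rw [binaryTree_degree_root hn]
  push_cast
  ring

end Tree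

/-! ### From inverse local times to the cover time -/

section CoverTime

/-- Chebyshev's inequality, with a deviation involving `x + a` instead of `x = √(2t)`: it stays
positive at `t = 0`, and the resulting bound does not depend on `t` or `n`. -/
theorem measure_inverseLocalTime_deviation_le {Ω : Type*} [MeasurableSpace Ω] {P : Measure Ω}
    [IsProbabilityMeasure P] {n : ℕ} (hn : 1 ≤ n) {X : ℝ≥0 → Ω → TreeVertex n}
    (hX : IsRandomWalk (binaryTree n) (treeRoot n) P X) {t a : ℝ} (ht : 0 ≤ t) (ha : 0 < a) :
    P {ω | treeInverseLocalTime n X t ω = ∞ ∨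
      ((binaryTree n).edgeFinset.card : ℝ) * (a * (√(2 * t) + a) / 2) ≤
        |(treeInverseLocalTime n X t ω).toReal - 2 * ((binaryTree n).edgeFinset.card : ℝ) * t|} ≤
      ENNReal.ofReal (96 / a ^ 2) := by
  obtain ⟨h1, h2, h3, h4⟩ := treeInverseLocalTime_moments hn hX ht
  have hE := two_pow_le_card_edgeFinset hn
  set E : ℝ := ((binaryTree n).edgeFinset.card : ℝ)
  have hp : (0 : ℝ) < 2 ^ n := by positivity
  have hE0 : 0 < E := hp.trans_le hE
  have hx : 0 ≤ √(2 * t) := Real.sqrt_nonneg _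
  have hx2 : √(2 * t) ^ 2 = 2 * t := Real.sq_sqrt (by positivity)
  set x := √(2 * t)
  have hδ : 0 < E * (a * (x + a) / 2) := by positivity
  have hcheb := meas_ge_le_variance_div_sq h2 hδ
  rw [h3] at hcheb
  have htop : P {ω | treeInverseLocalTime n X t ω = ∞} = 0 := by
    simpa [ae_iff] using h1
  rw [Set.ofPred_or]
  refine (measure_union_le _ _).trans ?_
  rw [htop, zero_add]
  refine hcheb.trans (ENNReal.ofReal_le_ofReal ?_)
  rw [div_le_div_iff₀ (by positivity) (by positivity)]
  calc _ ≤ 48 * 2 ^ (2 * n) * t * a ^ 2 := mul_le_mul_of_nonneg_right h4 (by positivity)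
    _ = 24 * a ^ 2 * ((2 ^ n) ^ 2 * x ^ 2) := by rw [hx2, pow_mul']; ring
    _ ≤ 24 * a ^ 2 * (E ^ 2 * (x + a) ^ 2) := by
        gcongr
        linarith
    _ = 96 * (E * (a * (x + a) / 2)) ^ 2 := by ring

lemma tendsto_measure_one_of_subset_union {Ω : ℕ → Type*} [∀ n, MeasurableSpace (Ω n)]
    {P : ∀ n, Measure (Ω n)} [∀ n, IsProbabilityMeasure (P n)] {A B C : ∀ n, Set (Ω n)}
    (hA : Tendsto (fun n => P n (A n)) atTop (𝓝 1))
    (hB : Tendsto (fun n => P n (B n)) atTop (𝓝 0))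
    (h : ∀ᶠ n in atTop, A n ⊆ C n ∪ B n) : Tendsto (fun n => P n (C n)) atTop (𝓝 1) := by
  have h1 := ENNReal.Tendsto.sub hA hB (Or.inl ENNReal.one_ne_top)
  rw [tsub_zero] at h1
  refine tendsto_of_tendsto_of_tendsto_of_le_of_le' h1 tendsto_const_nhds ?_
    (Eventually.of_forall fun n => prob_le_one)
  filter_upwards [h] with n hn
  exact tsub_le_iff_right.2 ((measure_mono hn).trans (measure_union_le _ _))

lemma ofReal_sq_rpow_half {y : ℝ} (hy : 0 ≤ y) :
    ENNReal.ofReal (y ^ 2) ^ (1 / 2 : ℝ) = ENNReal.ofReal y := by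
  rw [ENNReal.ofReal_rpow_of_nonneg (by positivity) (by norm_num), ← Real.sqrt_eq_rpow,
    Real.sqrt_sq hy]

lemma rpow_half_div_le {z : ℝ≥0∞} {E : ℕ} {y : ℝ} (hy : 0 ≤ y)
    (hz : z ≤ ENNReal.ofReal (E * y ^ 2)) :
    (z / (E : ℝ≥0∞)) ^ (1 / 2 : ℝ) ≤ ENNReal.ofReal y := by
  rw [← ofReal_sq_rpow_half hy]
  refine ENNReal.rpow_le_rpow (ENNReal.div_le_of_le_mul ?_) (by norm_num)
  rwa [mul_comm, ← ENNReal.ofReal_natCast, ← ENNReal.ofReal_mul (Nat.cast_nonneg E)]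

lemma le_rpow_half_div {z : ℝ≥0∞} {E : ℕ} (hE : 0 < E) {y : ℝ} (hy : 0 ≤ y)
    (hz : ENNReal.ofReal (E * y ^ 2) ≤ z) :
    ENNReal.ofReal y ≤ (z / (E : ℝ≥0∞)) ^ (1 / 2 : ℝ) := by
  rw [← ofReal_sq_rpow_half hy]
  refine ENNReal.rpow_le_rpow ?_ (by norm_num)
  rw [ENNReal.le_div_iff_mul_le (Or.inl (by exact_mod_cast hE.ne'))
    (Or.inl (ENNReal.natCast_ne_top E)), mul_comm, ← ENNReal.ofReal_natCast,
    ← ENNReal.ofReal_mul (Nat.cast_nonneg E)]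
  exact hz

end CoverTime

end

theorem mainTheorem4 :
    -- moments of the inverse local time, with a constant independent of `n` and `t`
    (∃ C : ℝ, ∀ (n : ℕ), 1 ≤ n → ∀ (Ω : Type u) [MeasurableSpace Ω] (P : Measure Ω)
      [IsProbabilityMeasure P] (X : ℝ≥0 → Ω → TreeVertex n),
      IsRandomWalk (binaryTree n) (treeRoot n) P X → ∀ t : ℝ, 0 ≤ t →
        (∀ᵐ ω ∂P, treeInverseLocalTime n X t ω < ∞) ∧
        MemLp (fun ω => (treeInverseLocalTime n X t ω).toReal) 2 P ∧
        P[fun ω => (treeInverseLocalTime n X t ω).toReal] =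
          2 * ((binaryTree n).edgeFinset.card : ℝ) * t ∧
        Var[fun ω => (treeInverseLocalTime n X t ω).toReal; P] ≤ C * 2 ^ (2 * n) * t) ∧
    -- conversion of bounds by inverse local times into bounds on the cover time
    (∀ (Ω : ℕ → Type u) [∀ n, MeasurableSpace (Ω n)] (P : ∀ n, Measure (Ω n))
      [∀ n, IsProbabilityMeasure (P n)] (X : ∀ n, ℝ≥0 → Ω n → TreeVertex n),
      (∀ n, 1 ≤ n → IsRandomWalk (binaryTree n) (treeRoot n) (P n) (X n)) →
      ∀ t a : ℕ → ℝ, (∀ n, 0 ≤ t n) → Tendsto a atTop atTop →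
        (Tendsto (fun n => P n {ω | coverTime (X n) ω ≤ treeInverseLocalTime n (X n) (t n) ω})
            atTop (𝓝 1) →
          Tendsto (fun n => P n {ω |
            (coverTime (X n) ω / ((binaryTree n).edgeFinset.card : ℝ≥0∞)) ^ (1 / 2 : ℝ) ≤
              ENNReal.ofReal (√(2 * t n) + a n)}) atTop (𝓝 1)) ∧
        (Tendsto (fun n => P n {ω | treeInverseLocalTime n (X n) (t n) ω ≤ coverTime (X n) ω})
            atTop (𝓝 1) →
          Tendsto (fun n => P n {ω | ENNReal.ofReal (√(2 * t n) - a n) ≤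
            (coverTime (X n) ω / ((binaryTree n).edgeFinset.card : ℝ≥0∞)) ^ (1 / 2 : ℝ)})
            atTop (𝓝 1))) := by
  refine ⟨⟨48, fun n hn Ω _ P _ X hX t ht => treeInverseLocalTime_moments hn hX ht⟩, ?_⟩
  intro Ω _ P _ X hX t a ht ha
  -- The infinite case must be listed separately because `toReal` sends `∞` to 0.
  let B : ∀ n, Set (Ω n) := fun n => {ω | treeInverseLocalTime n (X n) (t n) ω = ∞ ∨
    ((binaryTree n).edgeFinset.card : ℝ) * (a n * (√(2 * t n) + a n) / 2) ≤
      |(treeInverseLocalTime n (X n) (t n) ω).toReal -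
        2 * ((binaryTree n).edgeFinset.card : ℝ) * t n|}
  have hgood : ∀ᶠ n in atTop, 1 ≤ n ∧ 0 < a n :=
    (eventually_ge_atTop 1).and (ha.eventually_gt_atTop 0)
  have hB : Tendsto (fun n => P n (B n)) atTop (𝓝 0) := by
    have hlim : Tendsto (fun n => ENNReal.ofReal (96 / a n ^ 2)) atTop (𝓝 0) := by
      rw [← ENNReal.ofReal_zero]
      exact ENNReal.tendsto_ofReal
        (tendsto_const_nhds.div_atTop ((tendsto_pow_atTop two_ne_zero).comp ha))
    refine tendsto_of_tendsto_of_tendsto_of_le_of_le' tendsto_const_nhds hlim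
      (Eventually.of_forall fun _ => zero_le) ?_
    filter_upwards [hgood] with n hn
    exact measure_inverseLocalTime_deviation_le hn.1 (hX n hn.1) (ht n) hn.2
  constructor
  · intro hA
    refine tendsto_measure_one_of_subset_union hA hB ?_
    filter_upwards [hgood] with n ⟨hn, han⟩ ω hω
    by_cases hωB : ω ∈ B n
    · exact Or.inr hωB
    refine Or.inl ?_
    simp only [B, Set.mem_ofPred_eq, not_or, not_le] at hωB hω ⊢
    obtain ⟨hfin, hdev⟩ := hωB
    have hx : 0 ≤ √(2 * t n) := Real.sqrt_nonneg _
    have hx2 : √(2 * t n) ^ 2 = 2 * t n := Real.sq_sqrt (by linarith [ht n])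
    have hE : (0 : ℝ) ≤ (binaryTree n).edgeFinset.card := Nat.cast_nonneg _
    refine rpow_half_div_le (by positivity) (hω.trans ?_)
    rw [← ENNReal.ofReal_toReal hfin]
    refine ENNReal.ofReal_le_ofReal ?_
    have h1 := (abs_lt.1 hdev).2
    -- This is the slack in `x² + a(x + a)/2 ≤ (x + a)²`, times `|E|`.
    have h2 : 0 ≤ ((binaryTree n).edgeFinset.card : ℝ) *
        (3 / 2 * (a n * √(2 * t n)) + a n ^ 2 / 2) := by positivity
    nlinarith
  · intro hA
    refine tendsto_measure_one_of_subset_union hA hB ?_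
    filter_upwards [hgood] with n ⟨hn, han⟩ ω hω
    by_cases hωB : ω ∈ B n
    · exact Or.inr hωB
    refine Or.inl ?_
    simp only [B, Set.mem_ofPred_eq, not_or, not_le] at hωB hω ⊢
    obtain ⟨hfin, hdev⟩ := hωB
    -- If `x ≤ a` the lower bound is trivial, its `ofReal` being 0; squaring is legitimate only for
    -- `x > a`.
    rcases le_or_gt (√(2 * t n) - a n) 0 with hneg | hpos
    · rw [ENNReal.ofReal_of_nonpos hneg]
      exact zero_le
    have hx2 : √(2 * t n) ^ 2 = 2 * t n := Real.sq_sqrt (by linarith [ht n])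
    have hE : (0 : ℝ) < (binaryTree n).edgeFinset.card :=
      lt_of_lt_of_le (by positivity) (two_pow_le_card_edgeFinset hn)
    refine le_rpow_half_div (Nat.cast_pos.1 hE) hpos.le (le_trans ?_ hω)
    rw [← ENNReal.ofReal_toReal hfin]
    refine ENNReal.ofReal_le_ofReal ?_
    have h1 := (abs_lt.1 hdev).1
    -- This is the slack in `(x - a)² ≤ x² - a(x + a)/2`, times `|E|`; it is nonnegative because `x
    -- > a`.
    have h2 : 0 ≤ ((binaryTree n).edgeFinset.card : ℝ) *
        (3 / 2 * (a n * (√(2 * t n) - a n))) := by positivity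
    nlinarith
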